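/- Let $\mathbb K$ be $\mathbb R$ or $\mathbb C$. A \emph{Banach category} is a category enriched in the monoidal category of Banach spaces over $\mathbb K$ and linear contractions with the projective tensor product: its hom-sets are Banach spaces, composition satisfies $\|g\circ f\|\le\|g\|\,\|f\|$ and is bilinear, and $\|\mathrm{id}_a\|\le 1$. A \emph{contractive functor} is a functor that acts on morphisms by linear contractions; an \emph{isometric natural isomorphism} is a natural isomorphism whose components and their inverses are contractions. A \emph{Banach 2-space} is a Banach category having all small (weighted) colimits in the enriched sense, and a contractive functor is \emph{cocontinuous} if it preserves them. A contractive bifunctor $\mathcal A\otimes\mathcal B\to\mathcal C$ is \emph{bicocontinuous} if it is cocontinuous in each variable. A \emph{bitensor product} of Banach 2-spaces $\mathcal A$ and $\mathcal B$ is a Banach 2-space $\mathcal Z$ with a bicocontinuous contractive bifunctor $j\colon\mathcal A\otimes\mathcal B\to\mathcal Z$ which is universal: for every Banach 2-space $\mathcal C$, (i) for each bicocontinuous contractive bifunctor $\varphi\colon\mathcal A\otimes\mathcal B\to\mathcal C$ there is a cocontinuous contractive functor $T\colon\mathcal Z\to\mathcal C$ with $Tj$ isometrically isomorphic to $\varphi$;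 and (ii) for all cocontinuous contractive functors $S,T\colon\mathcal Z\to\mathcal C$ and every $M\ge 0$, each natural transformation $\sigma\colon Sj\to Tj$ with $\sup\|\sigma\|\le M$ is of the form $\tau j$ for a unique natural transformation $\tau\colon S\to T$ with $\sup\|\tau\|\le M$. In particular the functor $T$ in (i) is unique up to a unique compatible isometric natural isomorphism. For a set $X$, regarded as a discrete category, let $\ell_1(X)$ be the free Banach category on $X$: its objects are the elements of $X$, and its space of morphisms $x\to y$ is $\mathbb K$ if $x=y$ and $0$ otherwise. Let $\mathrm{PShv}(X)$ be the Banach category of contractive functors from $\ell_1(X)^{\mathrm{op}}$ to the Banach category of Banach spaces and bounded linear maps, with the uniformly bounded natural transformations, normed by the supremum norm, as morphisms. \textbf{Theorem (Fubini).} Let $X$ and $Y$ be sets. Then $\mathrm{PShv}(X)$ and $\mathrm{PShv}(Y)$ are Banach 2-spaces, and their bitensor product exists and is equivalent to $\mathrm{PShv}(X\times Y)$. That is, there is a bicocontinuous contractive bifunctor $i\colon \mathrm{PShv}(X)\otimes\mathrm{PShv}(Y)\to\mathrm{PShv}(X\times Y)$ which is a bitensor product; and for every bitensor product $j\colon \mathrm{PShv}(X)\otimes\mathrm{PShv}(Y)\to\mathcal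 Z$ there is an equivalence $E\colon\mathcal Z\to\mathrm{PShv}(X\times Y)$ of Banach 2-spaces (a cocontinuous contractive functor with a cocontinuous contractive inverse up to isometric natural isomorphism) such that $Ej$ is isometrically isomorphic to $i$. -/

import Mathlib

open CategoryTheory Opposite
open scoped ENNReal

universe v u u₁ u₂ u₃ w

/-! ### Banach categories: categories enriched in Banach spaces and linear contractions -/

/-- The part of the structure of a Banach category which does not mention the scalars. -/
class NormedCategory (C : Type u) [Category.{v} C] where
  homGroup (a b : C) : NormedAddCommGroup (a ⟶ b)
  complete (a b : C) : CompleteSpace (a ⟶ b)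
  add_comp {a b c : C} (f f' : a ⟶ b) (g : b ⟶ c) : (f + f') ≫ g = f ≫ g + f' ≫ g
  comp_add {a b c : C} (f : a ⟶ b) (g g' : b ⟶ c) : f ≫ (g + g') = f ≫ g + f ≫ g'
  norm_id_le (a : C) : ‖𝟙 a‖ ≤ 1
  norm_comp_le {a b c : C} (f : a ⟶ b) (g : b ⟶ c) : ‖f ≫ g‖ ≤ ‖f‖ * ‖g‖

attribute [reducible] NormedCategory.homGroup
attribute [instance] NormedCategory.homGroup NormedCategory.complete

/-- A Banach category over `𝕜`: the morphisms `a ⟶ b` form a Banach space, composition is a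
bilinear contraction (that is, a linear contraction on the projective tensor product), and
identities have norm at most one. -/
class BanachCategory (𝕜 : Type*) [RCLike 𝕜] (C : Type u) [Category.{v} C]
    [NormedCategory C] where
  homSpace (a b : C) : NormedSpace 𝕜 (a ⟶ b)
  smul_comp {a b c : C} (r : 𝕜) (f : a ⟶ b) (g : b ⟶ c) : (r • f) ≫ g = r • (f ≫ g)
  comp_smul {a b c : C} (r : 𝕜) (f : a ⟶ b) (g : b ⟶ c) : f ≫ (r • g) = r • (f ≫ g)

attribute [reducible] BanachCategory.homSpace
attribute [instance] BanachCategory.homSpace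

section Functors

variable (𝕜 : Type*) [RCLike 𝕜]
  (A : Type u₁) [Category.{v} A] [NormedCategory A] [BanachCategory 𝕜 A]
  (B : Type u₂) [Category.{v} B] [NormedCategory B] [BanachCategory 𝕜 B]
  (C : Type u₃) [Category.{v} C] [NormedCategory C] [BanachCategory 𝕜 C]

/-- A contractive functor: an ordinary functor acting on morphisms by linear contractions. -/
structure ContractiveFunctor extends A ⥤ B where
  map_add {a b : A} (f g : a ⟶ b) : map (f + g) = map f + map g
  map_smul {a b : A} (r : 𝕜) (f : a ⟶ b) : map (r • f) = r • map f
  norm_map_le {a b : A} (f : a ⟶ b) : ‖map f‖ ≤ ‖f‖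

/-- A contractive bifunctor `A ⊗ B → C`. The morphisms of `A ⊗ B` form the projective tensor
products `A(a, a') ⊗ B(b, b')`, hence by the universal property of the latter such a bifunctor is
an ordinary functor on `A × B` which acts on morphisms by bilinear contractions. -/
structure ContractiveBifunctor extends (A × B) ⥤ C where
  map_add_left {a a' : A} {b b' : B} (f f' : a ⟶ a') (g : b ⟶ b') :
    map (Prod.mkHom (f + f') g) = map (Prod.mkHom f g) + map (Prod.mkHom f' g)
  map_add_right {a a' : A} {b b' : B} (f : a ⟶ a') (g g' : b ⟶ b') :
    map (Prod.mkHom f (g + g')) = map (Prod.mkHom f g) + map (Prod.mkHom f g')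
  map_smul_left {a a' : A} {b b' : B} (r : 𝕜) (f : a ⟶ a') (g : b ⟶ b') :
    map (Prod.mkHom (r • f) g) = r • map (Prod.mkHom f g)
  map_smul_right {a a' : A} {b b' : B} (r : 𝕜) (f : a ⟶ a') (g : b ⟶ b') :
    map (Prod.mkHom f (r • g)) = r • map (Prod.mkHom f g)
  norm_map_le {a a' : A} {b b' : B} (f : a ⟶ a') (g : b ⟶ b') :
    ‖map (Prod.mkHom f g)‖ ≤ ‖f‖ * ‖g‖

end Functors

/-- The natural transformation `τ` is bounded by `M` in the supremum norm. It is contractive when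
it is bounded by `1`. -/
def NatTransBoundedBy {A : Type u₁} [Category.{v} A] {B : Type u₂} [Category.{v} B]
    [NormedCategory B] {F G : A ⥤ B} (τ : F ⟶ G) (M : ℝ) : Prop :=
  ∀ a, ‖τ.app a‖ ≤ M

/-- `F` and `G` are isometrically isomorphic: there is a natural isomorphism which is contractive
and has a contractive inverse. -/
def IsometricallyIsomorphic {A : Type u₁} [Category.{v} A] {B : Type u₂} [Category.{v} B]
    [NormedCategory B] (F G : A ⥤ B) : Prop :=
  ∃ e : F ≅ G, NatTransBoundedBy e.hom 1 ∧ NatTransBoundedBy e.inv 1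

namespace ContractiveFunctor

variable {𝕜 : Type*} [RCLike 𝕜]
  {A : Type u₁} [Category.{v} A] [NormedCategory A] [BanachCategory 𝕜 A]
  {B : Type u₂} [Category.{v} B] [NormedCategory B] [BanachCategory 𝕜 B]
  {C : Type u₃} [Category.{v} C] [NormedCategory C] [BanachCategory 𝕜 C]

/-- The action of a contractive functor on morphisms, as a continuous linear map. -/
def mapCLM (T : ContractiveFunctor 𝕜 A B) (a b : A) :
    (a ⟶ b) →L[𝕜] (T.obj a ⟶ T.obj b) :=
  LinearMap.mkContinuous
    { toFun := fun f => T.map f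
      map_add' := T.map_add
      map_smul' := T.map_smul } 1 (fun f => by simpa using T.norm_map_le f)

/-- Composition of contractive functors. -/
def comp (S : ContractiveFunctor 𝕜 A B) (T : ContractiveFunctor 𝕜 B C) :
    ContractiveFunctor 𝕜 A C where
  toFunctor := S.toFunctor ⋙ T.toFunctor
  map_add f g := by simp [S.map_add, T.map_add]
  map_smul r f := by simp [S.map_smul, T.map_smul]
  norm_map_le f := (T.norm_map_le _).trans (S.norm_map_le f)

end ContractiveFunctor

namespace ContractiveBifunctor

variable {𝕜 : Type*} [RCLike 𝕜]
  {A : Type u₁} [Category.{v} A] [NormedCategory A] [BanachCategory 𝕜 A]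
  {B : Type u₂} [Category.{v} B] [NormedCategory B] [BanachCategory 𝕜 B]
  {C : Type u₃} [Category.{v} C] [NormedCategory C] [BanachCategory 𝕜 C]

/-- The partial functor `φ(a, -)`. -/
def left (φ : ContractiveBifunctor 𝕜 A B C) (a : A) : ContractiveFunctor 𝕜 B C where
  obj b := φ.obj (a, b)
  map g := φ.map (Prod.mkHom (𝟙 a) g)
  map_id b := φ.map_id (a, b)
  map_comp g g' := by rw [← φ.map_comp]; simp
  map_add g g' := φ.map_add_right _ g g'
  map_smul r g := φ.map_smul_right r _ g
  norm_map_le g := (φ.norm_map_le (𝟙 a) g).trans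
    (mul_le_of_le_one_left (norm_nonneg g) (NormedCategory.norm_id_le a))

/-- The partial functor `φ(-, b)`. -/
def right (φ : ContractiveBifunctor 𝕜 A B C) (b : B) : ContractiveFunctor 𝕜 A C where
  obj a := φ.obj (a, b)
  map f := φ.map (Prod.mkHom f (𝟙 b))
  map_id a := φ.map_id (a, b)
  map_comp f f' := by rw [← φ.map_comp]; simp
  map_add f f' := φ.map_add_left f f' _
  map_smul r f := φ.map_smul_left r f _
  norm_map_le f := (φ.norm_map_le f (𝟙 b)).trans
    (mul_le_of_le_one_right (norm_nonneg f) (NormedCategory.norm_id_le b))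

end ContractiveBifunctor

/-! ### The Banach category of Banach spaces -/

/-- Banach spaces over `𝕜`. -/
structure Ban (𝕜 : Type v) [RCLike 𝕜] : Type (v + 1) where
  carrier : Type v
  [group : NormedAddCommGroup carrier]
  [space : NormedSpace 𝕜 carrier]
  [complete : CompleteSpace carrier]

namespace Ban

variable (𝕜 : Type v) [RCLike 𝕜]

instance : CoeSort (Ban 𝕜) (Type v) := ⟨Ban.carrier⟩

attribute [instance] Ban.group Ban.space Ban.complete

/-- The morphisms are all bounded linear maps. -/
instance : Category (Ban 𝕜) where
  Hom E F := E →L[𝕜] F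
  id E := ContinuousLinearMap.id 𝕜 E
  comp f g := g.comp f

noncomputable instance : NormedCategory (Ban 𝕜) where
  homGroup E F := ContinuousLinearMap.toNormedAddCommGroup (E := E) (F := F) (σ₁₂ := RingHom.id 𝕜)
  complete E F := inferInstanceAs (CompleteSpace (E →L[𝕜] F))
  add_comp f f' g := ContinuousLinearMap.comp_add g f f'
  comp_add f g g' := ContinuousLinearMap.add_comp g g' f
  norm_id_le _ := ContinuousLinearMap.norm_id_le
  norm_comp_le f g := (ContinuousLinearMap.opNorm_comp_le g f).trans_eq (mul_comm _ _)

noncomputable instance : BanachCategory 𝕜 (Ban 𝕜) where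
  homSpace E F := ContinuousLinearMap.toNormedSpace (E := E) (F := F) (σ₁₂ := RingHom.id 𝕜)
  smul_comp r f g := ContinuousLinearMap.comp_smul g r f
  comp_smul r f g := ContinuousLinearMap.smul_comp r g f

end Ban

/-! ### Presheaves -/

/-- A presheaf on a small Banach category `A`: a contractive functor `Aᵒᵖ ⥤ Ban 𝕜`. -/
structure PShv (𝕜 : Type v) [RCLike 𝕜] (A : Type v) [Category.{v} A] [NormedCategory A]
    [BanachCategory 𝕜 A] : Type (v + 1) where
  toFunctor : Aᵒᵖ ⥤ Ban 𝕜
  map_add {a b : A} (f g : a ⟶ b) :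
    toFunctor.map (f + g).op = toFunctor.map f.op + toFunctor.map g.op
  map_smul {a b : A} (r : 𝕜) (f : a ⟶ b) : toFunctor.map (r • f).op = r • toFunctor.map f.op
  norm_map_le {a b : A} (f : a ⟶ b) : ‖toFunctor.map f.op‖ ≤ ‖f‖

namespace PShv

variable {𝕜 : Type v} [RCLike 𝕜] {A : Type v} [Category.{v} A] [NormedCategory A]
    [BanachCategory 𝕜 A]

/-- The value of a presheaf at `a`. -/
abbrev val (ξ : PShv 𝕜 A) (a : A) : Type v := (ξ.toFunctor.obj (op a)).carrier

/-- The restriction map along `f : a ⟶ b`. -/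
def res (ξ : PShv 𝕜 A) {a b : A} (f : a ⟶ b) : ξ.val b →L[𝕜] ξ.val a := ξ.toFunctor.map f.op

/-- Families `τ a : ξ a → ζ a` of bounded linear maps with `sup ‖τ a‖ < ∞`, with the supremum
norm. -/
abbrev Families (ξ ζ : PShv 𝕜 A) : Type v := lp (fun a : A => ξ.val a →L[𝕜] ζ.val a) ∞

/-- The uniformly bounded natural transformations `ξ → ζ`, with the supremum norm. -/
def homSubmodule (ξ ζ : PShv 𝕜 A) : Submodule 𝕜 (Families ξ ζ) where
  carrier := {τ | ∀ (a b : A) (f : a ⟶ b) (x : ξ.val b), τ a (ξ.res f x) = ζ.res f (τ b x)}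
  add_mem' {σ τ} hσ hτ a b f x := by simp [hσ a b f x, hτ a b f x]
  zero_mem' a b f x := by simp
  smul_mem' r τ hτ a b f x := by simp [hτ a b f x]

theorem isClosed_homSubmodule (ξ ζ : PShv 𝕜 A) :
    IsClosed (homSubmodule ξ ζ : Set (Families ξ ζ)) := by
  have hc : ∀ (a : A) (x : ξ.val a), Continuous fun τ : Families ξ ζ => τ a x := fun a x =>
    (ContinuousLinearMap.apply 𝕜 (ζ.val a) x).continuous.comp
      (lp.lipschitzWith_one_eval (E := fun a : A => ξ.val a →L[𝕜] ζ.val a) ∞ a).continuous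
  have : (homSubmodule ξ ζ : Set (Families ξ ζ)) =
      ⋂ (a : A), ⋂ (b : A), ⋂ (f : a ⟶ b), ⋂ (x : ξ.val b),
        {τ | τ a (ξ.res f x) = ζ.res f (τ b x)} := by
    ext τ
    simp only [Set.mem_iInter]
    exact Iff.rfl
  rw [this]
  exact isClosed_iInter fun a => isClosed_iInter fun b => isClosed_iInter fun f =>
    isClosed_iInter fun x =>
      isClosed_eq (hc a _) ((ζ.res f).continuous.comp (hc b x))

/-- Morphisms of presheaves are the uniformly bounded natural transformations. -/
instance : CategoryStruct (PShv 𝕜 A) where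
  Hom ξ ζ := homSubmodule ξ ζ
  id ξ := ⟨⟨fun a => ContinuousLinearMap.id 𝕜 (ξ.val a), memℓp_infty ⟨1, by
      rintro _ ⟨a, rfl⟩; exact ContinuousLinearMap.norm_id_le⟩⟩, fun _ _ _ _ => rfl⟩
  comp {ξ ζ χ} σ τ := ⟨⟨fun a => (τ.1 a).comp (σ.1 a), memℓp_infty ⟨‖σ.1‖ * ‖τ.1‖, by
      rintro _ ⟨a, rfl⟩
      refine (ContinuousLinearMap.opNorm_comp_le _ _).trans ?_
      rw [mul_comm]
      exact mul_le_mul (lp.norm_apply_le_norm ENNReal.top_ne_zero σ.1 a)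
        (lp.norm_apply_le_norm ENNReal.top_ne_zero τ.1 a) (norm_nonneg _) (norm_nonneg _)⟩⟩,
    fun a b f x => by
      have h1 := σ.2 a b f x
      have h2 := τ.2 a b f (σ.1 b x)
      exact (congrArg (τ.1 a) h1).trans h2⟩

theorem hom_ext {ξ ζ : PShv 𝕜 A} {σ τ : ξ ⟶ ζ} (h : ∀ a, σ.1 a = τ.1 a) : σ = τ :=
  Subtype.ext (lp.ext (funext h))

instance : Category (PShv 𝕜 A) where

noncomputable instance : NormedCategory (PShv 𝕜 A) where
  homGroup ξ ζ := (homSubmodule ξ ζ).normedAddCommGroup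
  complete ξ ζ := (isClosed_homSubmodule ξ ζ).completeSpace_coe
  add_comp σ σ' τ := hom_ext fun a => ContinuousLinearMap.comp_add (τ.1 a) (σ.1 a) (σ'.1 a)
  comp_add σ τ τ' := hom_ext fun a => ContinuousLinearMap.add_comp (τ.1 a) (τ'.1 a) (σ.1 a)
  norm_id_le ξ := lp.norm_le_of_forall_le zero_le_one fun _ => ContinuousLinearMap.norm_id_le
  norm_comp_le σ τ := lp.norm_le_of_forall_le (mul_nonneg (norm_nonneg σ.1) (norm_nonneg τ.1))
    fun a => by
      refine (ContinuousLinearMap.opNorm_comp_le (τ.1 a) (σ.1 a)).trans ?_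
      rw [mul_comm]
      exact mul_le_mul (lp.norm_apply_le_norm ENNReal.top_ne_zero σ.1 a)
        (lp.norm_apply_le_norm ENNReal.top_ne_zero τ.1 a) (norm_nonneg (τ.1 a)) (norm_nonneg σ.1)

noncomputable instance : BanachCategory 𝕜 (PShv 𝕜 A) where
  homSpace ξ ζ := (homSubmodule ξ ζ).normedSpace
  smul_comp r σ τ := hom_ext fun a => ContinuousLinearMap.comp_smul (τ.1 a) r (σ.1 a)
  comp_smul r σ τ := hom_ext fun a => ContinuousLinearMap.smul_comp r (τ.1 a) (σ.1 a)

end PShv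

/-! ### Weighted colimits, Banach 2-spaces and cocontinuous functors -/

section Colimits

variable {𝕜 : Type v} [RCLike 𝕜]
  {K : Type v} [Category.{v} K] [NormedCategory K] [BanachCategory 𝕜 K]
  {C : Type u} [Category.{v} C] [NormedCategory C] [BanachCategory 𝕜 C]

/-- A cocone over `F : K ⥤ C` with weight `W : Kᵒᵖ ⥤ Ban` and vertex `c`, that is, a natural
transformation `W → C(F -, c)`. -/
structure WeightedCocone (W : PShv 𝕜 K) (F : ContractiveFunctor 𝕜 K C) (c : C) where
  app (k : K) : W.val k →L[𝕜] (F.obj k ⟶ c)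
  naturality {k l : K} (f : k ⟶ l) (x : W.val l) : app k (W.res f x) = F.map f ≫ app l x

/-- `φ` exhibits `c` as the `W`-weighted colimit of `F`: composition with `φ` is an isometric
isomorphism from `C(c, d)` onto the space of bounded natural transformations `W → C(F -, d)`, for
every object `d`. -/
structure WeightedCocone.IsColimit {W : PShv 𝕜 K} {F : ContractiveFunctor 𝕜 K C} {c : C}
    (φ : WeightedCocone W F c) : Prop where
  contractive : ∀ k, ‖φ.app k‖ ≤ 1
  universal : ∀ (d : C) (ψ : WeightedCocone W F d) (M : ℝ), 0 ≤ M → (∀ k, ‖ψ.app k‖ ≤ M) →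
    ∃ g : c ⟶ d, ‖g‖ ≤ M ∧ (∀ (k : K) (x : W.val k), φ.app k x ≫ g = ψ.app k x) ∧
      ∀ g' : c ⟶ d, (∀ (k : K) (x : W.val k), φ.app k x ≫ g' = ψ.app k x) → g' = g

/-- The image of a weighted cocone under a contractive functor. -/
def WeightedCocone.mapCocone {D : Type w} [Category.{v} D] [NormedCategory D] [BanachCategory 𝕜 D]
    {W : PShv 𝕜 K} {F : ContractiveFunctor 𝕜 K C} {c : C} (φ : WeightedCocone W F c)
    (T : ContractiveFunctor 𝕜 C D) : WeightedCocone W (F.comp T) (T.obj c) where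
  app k := (T.mapCLM (F.obj k) c).comp (φ.app k)
  naturality {k l} f x := by
    change T.map (φ.app k (W.res f x)) = T.map (F.map f) ≫ T.map (φ.app l x)
    rw [φ.naturality, T.map_comp]

end Colimits

/-- A Banach 2-space is a cocomplete Banach category: all colimits of contractive functors on
small Banach categories, weighted by presheaves, exist. -/
def IsBanachTwoSpace (𝕜 : Type v) [RCLike 𝕜] (C : Type u) [Category.{v} C] [NormedCategory C]
    [BanachCategory 𝕜 C] : Prop :=
  ∀ (K : Type v) [Category.{v} K] [NormedCategory K] [BanachCategory 𝕜 K]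
    (W : PShv 𝕜 K) (F : ContractiveFunctor 𝕜 K C),
    ∃ (c : C) (φ : WeightedCocone W F c), φ.IsColimit

/-- A contractive functor is cocontinuous if it preserves all small weighted colimits. -/
def ContractiveFunctor.IsCocontinuous {𝕜 : Type v} [RCLike 𝕜]
    {C : Type u₁} [Category.{v} C] [NormedCategory C] [BanachCategory 𝕜 C]
    {D : Type u₂} [Category.{v} D] [NormedCategory D] [BanachCategory 𝕜 D]
    (T : ContractiveFunctor 𝕜 C D) : Prop :=
  ∀ (K : Type v) [Category.{v} K] [NormedCategory K] [BanachCategory 𝕜 K]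
    (W : PShv 𝕜 K) (F : ContractiveFunctor 𝕜 K C) (c : C) (φ : WeightedCocone W F c),
    φ.IsColimit → (φ.mapCocone T).IsColimit

/-- A contractive functor is an equivalence of Banach 2-spaces if it is cocontinuous and has a
cocontinuous inverse up to isometric natural isomorphism. -/
def ContractiveFunctor.IsBanachEquivalence {𝕜 : Type v} [RCLike 𝕜]
    {C : Type u₁} [Category.{v} C] [NormedCategory C] [BanachCategory 𝕜 C]
    {D : Type u₂} [Category.{v} D] [NormedCategory D] [BanachCategory 𝕜 D]
    (T : ContractiveFunctor 𝕜 C D) : Prop :=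
  T.IsCocontinuous ∧ ∃ S : ContractiveFunctor 𝕜 D C, S.IsCocontinuous ∧
    IsometricallyIsomorphic (T.toFunctor ⋙ S.toFunctor) (𝟭 C) ∧
    IsometricallyIsomorphic (S.toFunctor ⋙ T.toFunctor) (𝟭 D)

/-- A bifunctor is bicocontinuous if it is cocontinuous in each variable. -/
def ContractiveBifunctor.IsBicocontinuous {𝕜 : Type v} [RCLike 𝕜]
    {A : Type u₁} [Category.{v} A] [NormedCategory A] [BanachCategory 𝕜 A]
    {B : Type u₂} [Category.{v} B] [NormedCategory B] [BanachCategory 𝕜 B]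
    {C : Type u₃} [Category.{v} C] [NormedCategory C] [BanachCategory 𝕜 C]
    (φ : ContractiveBifunctor 𝕜 A B C) : Prop :=
  (∀ a, (φ.left a).IsCocontinuous) ∧ ∀ b, (φ.right b).IsCocontinuous

/-! ### Bitensor products -/

/-- The bicocontinuous bifunctor `j : A ⊗ B → Z` exhibits the Banach 2-space `Z` as the bitensor
product of `A` and `B`: for every Banach 2-space `C`, composition with `j` is an equivalence from
the category of cocontinuous functors `Z → C` to the category of bicocontinuous bifunctors
`A ⊗ B → C`. The field `factorization` is essential surjectivity. The field `extension` says that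
composition with `j` is an isometric bijection on bounded natural transformations; applied to
isometric natural isomorphisms and their inverses it makes the factorization of a bifunctor through
`j` unique up to a unique isometric natural isomorphism. -/
structure IsBitensorProduct {𝕜 : Type v} [RCLike 𝕜]
    {A : Type u₁} [Category.{v} A] [NormedCategory A] [BanachCategory 𝕜 A]
    {B : Type u₂} [Category.{v} B] [NormedCategory B] [BanachCategory 𝕜 B]
    {Z : Type u₃} [Category.{v} Z] [NormedCategory Z] [BanachCategory 𝕜 Z]
    (j : ContractiveBifunctor 𝕜 A B Z) : Prop where
  isBanachTwoSpace : IsBanachTwoSpace 𝕜 Z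
  isBicocontinuous : j.IsBicocontinuous
  factorization : ∀ (C : Type w) [Category.{v} C] [NormedCategory C] [BanachCategory 𝕜 C],
    IsBanachTwoSpace 𝕜 C → ∀ φ : ContractiveBifunctor 𝕜 A B C, φ.IsBicocontinuous →
      ∃ T : ContractiveFunctor 𝕜 Z C, T.IsCocontinuous ∧
        IsometricallyIsomorphic (j.toFunctor ⋙ T.toFunctor) φ.toFunctor
  extension : ∀ (C : Type w) [Category.{v} C] [NormedCategory C] [BanachCategory 𝕜 C],
    IsBanachTwoSpace 𝕜 C → ∀ S T : ContractiveFunctor 𝕜 Z C, S.IsCocontinuous →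
      T.IsCocontinuous →
      ∀ (σ : j.toFunctor ⋙ S.toFunctor ⟶ j.toFunctor ⋙ T.toFunctor) (M : ℝ), 0 ≤ M →
        NatTransBoundedBy σ M →
        ∃! τ : S.toFunctor ⟶ T.toFunctor,
          NatTransBoundedBy τ M ∧ ∀ p, τ.app (j.obj p) = σ.app p

/-! ### Sets as Banach categories -/

/-- The free Banach category on a set `X`, viewed as a discrete category. -/
structure FreeBanachCategory (𝕜 : Type v) (X : Type v) : Type v where
  as : X

namespace FreeBanachCategory

variable {𝕜 : Type v} [RCLike 𝕜] {X : Type v}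

/-- The Banach space of morphisms `x ⟶ y` is `ℓ₁` of the set of morphisms in the discrete category
`X`, that is, `𝕜` if `x = y` and `0` otherwise. -/
def homSubmodule (x y : X) : Submodule 𝕜 𝕜 where
  carrier := {r | x ≠ y → r = 0}
  add_mem' hr hs h := by rw [hr h, hs h, add_zero]
  zero_mem' _ := rfl
  smul_mem' c r hr h := by rw [hr h, smul_zero]

instance : Category.{v} (FreeBanachCategory 𝕜 X) where
  Hom x y := homSubmodule (𝕜 := 𝕜) x.as y.as
  id _ := ⟨1, fun h => absurd rfl h⟩
  comp {x y z} r s := ⟨r.1 * s.1, fun h => by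
    by_cases hxy : x.as = y.as
    · rw [s.2 (fun hyz => h (hxy.trans hyz)), mul_zero]
    · rw [r.2 hxy, zero_mul]⟩
  id_comp r := Subtype.ext (one_mul r.1)
  comp_id r := Subtype.ext (mul_one r.1)
  assoc r s t := Subtype.ext (mul_assoc r.1 s.1 t.1)

noncomputable instance : NormedCategory (FreeBanachCategory 𝕜 X) where
  homGroup x y := (homSubmodule (𝕜 := 𝕜) x.as y.as).normedAddCommGroup
  complete x y := (homSubmodule (𝕜 := 𝕜) x.as y.as).closed_of_finiteDimensional.completeSpace_coe
  add_comp r r' s := Subtype.ext (add_mul r.1 r'.1 s.1)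
  comp_add r s s' := Subtype.ext (mul_add r.1 s.1 s'.1)
  norm_id_le _ := (norm_one (α := 𝕜)).le
  norm_comp_le r s := (norm_mul r.1 s.1).le

noncomputable instance : BanachCategory 𝕜 (FreeBanachCategory 𝕜 X) where
  homSpace x y := (homSubmodule (𝕜 := 𝕜) x.as y.as).normedSpace
  smul_comp c r s := Subtype.ext (mul_assoc c r.1 s.1)
  comp_smul c r s := Subtype.ext (mul_left_comm r.1 c s.1)

end FreeBanachCategory

/-- The free Banach 2-space `PShv(X)` over a set `X`. -/
abbrev PShvSet (𝕜 : Type v) [RCLike 𝕜] (X : Type v) : Type (v + 1) :=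
  PShv 𝕜 (FreeBanachCategory 𝕜 X)

/-! Every presheaf is the colimit, weighted by itself, of representable presheaves
(`PShv.density_isColimit`). Hence bounded transformations out of a cocontinuous functor on
presheaves extend uniquely, and with the same bound, from the representables
(`PShv.exists_natTrans_extension`, `PShv.natTrans_ext`). A contractive functor `F` from a small
Banach category into a Banach 2-space extends cocontinuously by sending `ξ` to the `ξ`-weighted
colimit of `F` (`PShv.lan`). Over a set, naturality on representables is automatic
(`FreeBanachCategory.naturality`), so the data to be extended are plain families of objects and
bounded families of morphisms.

The universal bifunctor is the pointwise projective tensor product, `(x, y) ↦ ξ(x) ⊗ ζ(y)`. Currying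
is isometric and gives it a right adjoint in each variable, so it is bicocontinuous
(`ContractiveFunctor.isCocontinuous_of_representable`). It sends the representables at `a` and `b`
to the representable at `(a, b)` (`PShvSet.exists_tensor_yoneda_iso`). A bicocontinuous bifunctor on
the two factors and a cocontinuous functor on presheaves over `X × Y` are therefore both controlled
by families indexed by `X × Y`. This yields factorization and extension; uniqueness of the bitensor
product is then formal.

The analytic input is the construction of projective tensor products and of weighted colimits of
Banach spaces. Both are closed spans of evaluation functionals, inside the dual of the space of
bilinear forms or of bounded scalar cocones. Maps out of them have the right norm by Hahn–Banach:
the target embeds isometrically in its bidual, so it is enough to transpose a map out of its dual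
(`closedSpan.exists_lift_dual`). -/

set_option maxSynthPendingDepth 3

/-! ### Closed linear spans -/

section ClosedSpan

variable {𝕜 : Type*} [RCLike 𝕜] {D : Type*} [NormedAddCommGroup D] [NormedSpace 𝕜 D]
  {S : Type*} (ev : S → D)
  {G : Type*} [NormedAddCommGroup G] [NormedSpace 𝕜 G]

variable (𝕜) in
/-- The closed linear span of a family of vectors. -/
def closedSpan : Submodule 𝕜 D :=
  (Submodule.span 𝕜 (Set.range ev)).topologicalClosure

instance [CompleteSpace D] : CompleteSpace (closedSpan 𝕜 ev) :=
  (Submodule.isClosed_topologicalClosure _).completeSpace_coe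

variable (𝕜) in
/-- The generators of the closed linear span. -/
def closedSpan.gen (s : S) : closedSpan 𝕜 ev :=
  ⟨ev s, Submodule.le_topologicalClosure _ (Submodule.subset_span ⟨s, rfl⟩)⟩

variable {ev}

/-- The kernel of the difference is closed in the span and hence in `D`, because the span is itself
closed. A closed subspace that contains the generators contains their closed span. -/
theorem closedSpan.hom_ext {g g' : closedSpan 𝕜 ev →L[𝕜] G}
    (h : ∀ s, g (gen 𝕜 ev s) = g' (gen 𝕜 ev s)) : g = g' := by
  let K : Submodule 𝕜 (closedSpan 𝕜 ev) := (g - g').ker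
  have hK : IsClosed ((K.map (closedSpan 𝕜 ev).subtype : Submodule 𝕜 D) : Set D) := by
    have hemb : Topology.IsClosedEmbedding (Subtype.val : closedSpan 𝕜 ev → D) :=
      (Submodule.isClosed_topologicalClosure _).isClosedEmbedding_subtypeVal
    exact hemb.isClosedMap _ (g - g').isClosed_ker
  have hle : closedSpan 𝕜 ev ≤ K.map (closedSpan 𝕜 ev).subtype := by
    refine Submodule.topologicalClosure_minimal _ (Submodule.span_le.2 ?_) hK
    rintro _ ⟨s, rfl⟩
    exact ⟨gen 𝕜 ev s, by simp [K, h s], rfl⟩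
  ext ⟨u, hu⟩
  obtain ⟨⟨u', hu'⟩, hu1, rfl⟩ := hle hu
  simpa [K, sub_eq_zero] using hu1

/-- An isometric image of a complete space is closed, so the vectors that `adj` sends into the range
of `ι` form a closed subspace. It contains the generators, hence the closed span, on which `ι` can
be inverted without changing norms. -/
theorem closedSpan.exists_lift [CompleteSpace G] {D' : Type*} [NormedAddCommGroup D']
    [NormedSpace 𝕜 D'] (ι : G →ₗᵢ[𝕜] D') (adj : D →L[𝕜] D') (b : S → G)
    (h : ∀ s, adj (ev s) = ι (b s)) :
    ∃ g : closedSpan 𝕜 ev →L[𝕜] G, ‖g‖ ≤ ‖adj‖ ∧ ∀ s, g (gen 𝕜 ev s) = b s := by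
  have hmem : closedSpan 𝕜 ev ≤ (LinearMap.range ι.toLinearMap).comap (adj : D →ₗ[𝕜] D') := by
    refine Submodule.topologicalClosure_minimal _ (Submodule.span_le.2 ?_) ?_
    · rintro _ ⟨s, rfl⟩
      exact ⟨b s, (h s).symm⟩
    · have : IsClosed (LinearMap.range ι.toLinearMap : Set D') :=
        ι.isometry.isClosedEmbedding.isClosed_range
      exact this.preimage adj.continuous
  let e := ι.equivRange
  let r : closedSpan 𝕜 ev →L[𝕜] LinearMap.range ι.toLinearMap :=
    (adj.comp (closedSpan 𝕜 ev).subtypeL).codRestrict _ (fun u => hmem u.2)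
  have hr : ∀ u, ι (e.symm (r u)) = adj u := fun u =>
    congrArg Subtype.val (e.apply_symm_apply (r u))
  refine ⟨(e.symm.toContinuousLinearEquiv : _ →L[𝕜] G).comp r, ?_, fun s => ?_⟩
  · refine ContinuousLinearMap.opNorm_le_bound _ (norm_nonneg _) fun u => ?_
    change ‖e.symm (r u)‖ ≤ _
    rw [← ι.norm_map, hr]
    exact adj.le_opNorm _
  · exact ι.injective ((hr _).trans (h s))

/-- The map out of the closed span of a family of functionals which is induced by a map `β` out of
the dual of the target. -/
theorem closedSpan.exists_lift_dual [CompleteSpace G] {N : Type*} [NormedAddCommGroup N]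
    [NormedSpace 𝕜 N] {ev : S → N →L[𝕜] 𝕜} (b : S → G) (β : (G →L[𝕜] 𝕜) →L[𝕜] N)
    (h : ∀ s g, ev s (β g) = g (b s)) :
    ∃ g : closedSpan 𝕜 ev →L[𝕜] G, ‖g‖ ≤ ‖β‖ ∧ ∀ s, g (gen 𝕜 ev s) = b s := by
  -- Transpose of `β`: it moves functionals on `N` into the bidual of `G`, where Hahn–Banach embeds
  -- `G` isometrically.
  let adj : (N →L[𝕜] 𝕜) →L[𝕜] ((G →L[𝕜] 𝕜) →L[𝕜] 𝕜) :=
    (ContinuousLinearMap.compL 𝕜 (G →L[𝕜] 𝕜) N 𝕜).flip β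
  obtain ⟨g, hg, hg'⟩ := closedSpan.exists_lift (NormedSpace.inclusionInDoubleDualLi (E := G) 𝕜)
    adj b (fun s => by ext g; exact h s g)
  refine ⟨g, hg.trans (ContinuousLinearMap.opNorm_le_bound _ (norm_nonneg _) fun u => ?_), hg'⟩
  rw [mul_comm]
  exact ContinuousLinearMap.opNorm_comp_le u β

end ClosedSpan

/-! ### The projective tensor product of Banach spaces -/

namespace Ban

variable {𝕜 : Type v} [RCLike 𝕜]

section Tensor

variable (E F : Type v) [NormedAddCommGroup E] [NormedSpace 𝕜 E]
  [NormedAddCommGroup F] [NormedSpace 𝕜 F]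

/-- Evaluation of bilinear forms at a pair of vectors. -/
noncomputable def bilinEval (p : E × F) : (E →L[𝕜] F →L[𝕜] 𝕜) →L[𝕜] 𝕜 :=
  (ContinuousLinearMap.apply 𝕜 𝕜 p.2).comp (ContinuousLinearMap.apply 𝕜 (F →L[𝕜] 𝕜) p.1)

/-- The projective tensor product, realized inside the dual of the space of bilinear forms. -/
noncomputable def tensor : Ban 𝕜 where
  carrier := closedSpan 𝕜 (bilinEval (𝕜 := 𝕜) E F)

variable {E F}

/-- The universal bilinear contraction. -/
noncomputable def tmul : E →L[𝕜] F →L[𝕜] tensor (𝕜 := 𝕜) E F :=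
  LinearMap.mkContinuous₂ (LinearMap.mk₂ 𝕜
    (fun e f => (closedSpan.gen 𝕜 (bilinEval (𝕜 := 𝕜) E F) (e, f) : tensor (𝕜 := 𝕜) E F))
    (fun e e' f => Subtype.ext (ContinuousLinearMap.ext fun B =>
      show B (e + e') f = B e f + B e' f by simp))
    (fun r e f => Subtype.ext (ContinuousLinearMap.ext fun B =>
      show B (r • e) f = r • B e f by simp))
    (fun e f f' => Subtype.ext (ContinuousLinearMap.ext fun B =>
      show B e (f + f') = B e f + B e f' by simp))
    (fun r e f => Subtype.ext (ContinuousLinearMap.ext fun B =>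
      show B e (r • f) = r • B e f by simp))) 1 (fun e f => by
    refine ContinuousLinearMap.opNorm_le_bound _ (by positivity) fun B => ?_
    refine (B.le_opNorm₂ e f).trans_eq ?_
    ring)

theorem norm_tmul_le (e : E) (f : F) : ‖tmul (𝕜 := 𝕜) e f‖ ≤ ‖e‖ * ‖f‖ := by
  refine (ContinuousLinearMap.le_opNorm₂ _ e f).trans ?_
  rw [mul_assoc]
  exact mul_le_of_le_one_left (by positivity)
    (LinearMap.mkContinuous₂_norm_le _ zero_le_one _)

variable {G : Type v} [NormedAddCommGroup G] [NormedSpace 𝕜 G]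

theorem tensor_hom_ext {g g' : tensor (𝕜 := 𝕜) E F →L[𝕜] G}
    (h : ∀ e f, g (tmul e f) = g' (tmul e f)) : g = g' :=
  closedSpan.hom_ext fun s => h s.1 s.2

theorem exists_tensorLift [CompleteSpace G] (B : E →L[𝕜] F →L[𝕜] G) :
    ∃ g : tensor (𝕜 := 𝕜) E F →L[𝕜] G, ‖g‖ ≤ ‖B‖ ∧ ∀ e f, g (tmul e f) = B e f := by
  -- Composing `B` with a functional on `G` gives a bilinear form; the transpose of this assignment
  -- takes evaluation at `(e, f)` to evaluation at `B e f`.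
  let β : (G →L[𝕜] 𝕜) →L[𝕜] (E →L[𝕜] F →L[𝕜] 𝕜) :=
    LinearMap.mkContinuous
      { toFun := fun g => ((ContinuousLinearMap.compL 𝕜 F G 𝕜) g).comp B
        map_add' := fun g g' => by ext; simp
        map_smul' := fun r g => by ext; simp } ‖B‖ (fun g => by
      refine ContinuousLinearMap.opNorm_le_bound₂ _ (by positivity) fun e f => ?_
      refine (g.le_opNorm (B e f)).trans ?_
      calc ‖g‖ * ‖B e f‖ ≤ ‖g‖ * (‖B‖ * ‖e‖ * ‖f‖) := by gcongr; exact B.le_opNorm₂ e f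
        _ = _ := by ring)
  obtain ⟨g, hg, hg'⟩ := closedSpan.exists_lift_dual (ev := bilinEval (𝕜 := 𝕜) E F)
    (fun p => B p.1 p.2) β (fun s g => rfl)
  exact ⟨g, hg.trans (LinearMap.mkContinuous_norm_le _ (norm_nonneg _) _),
    fun e f => hg' (e, f)⟩

/-- The linear map on the tensor product induced by a bilinear map. -/
noncomputable def tensorLift [CompleteSpace G] (B : E →L[𝕜] F →L[𝕜] G) :
    tensor (𝕜 := 𝕜) E F →L[𝕜] G := (exists_tensorLift B).choose

theorem norm_tensorLift_le [CompleteSpace G] (B : E →L[𝕜] F →L[𝕜] G) :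
    ‖tensorLift B‖ ≤ ‖B‖ := (exists_tensorLift B).choose_spec.1

@[simp]
theorem tensorLift_tmul [CompleteSpace G] (B : E →L[𝕜] F →L[𝕜] G) (e : E) (f : F) :
    tensorLift B (tmul e f) = B e f := (exists_tensorLift B).choose_spec.2 e f

variable {E' F' : Type v} [NormedAddCommGroup E'] [NormedSpace 𝕜 E']
  [NormedAddCommGroup F'] [NormedSpace 𝕜 F']

/-- The tensor product of bounded linear maps. -/
noncomputable def tensorMap (f : E →L[𝕜] E') (g : F →L[𝕜] F') :
    tensor (𝕜 := 𝕜) E F →L[𝕜] tensor (𝕜 := 𝕜) E' F' :=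
  tensorLift (tmul.bilinearComp f g)

@[simp]
theorem tensorMap_tmul (f : E →L[𝕜] E') (g : F →L[𝕜] F') (x : E) (y : F) :
    tensorMap f g (tmul x y) = tmul (f x) (g y) := by
  simp [tensorMap]

theorem norm_tensorMap_le (f : E →L[𝕜] E') (g : F →L[𝕜] F') :
    ‖tensorMap f g‖ ≤ ‖f‖ * ‖g‖ := by
  refine (norm_tensorLift_le _).trans
    (ContinuousLinearMap.opNorm_le_bound₂ _ (by positivity) fun x y => ?_)
  refine (norm_tmul_le (f x) (g y)).trans ?_
  calc ‖f x‖ * ‖g y‖ ≤ (‖f‖ * ‖x‖) * (‖g‖ * ‖y‖) := by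
        gcongr <;> exact ContinuousLinearMap.le_opNorm _ _
    _ = _ := by ring

end Tensor

end Ban

/-! ### Composition as a bounded linear map -/

namespace BanachCategory

variable (𝕜 : Type*) [RCLike 𝕜]
  {C : Type u} [Category.{v} C] [NormedCategory C] [BanachCategory 𝕜 C]

/-- Precomposition with a morphism. -/
def precomp {a b : C} (f : a ⟶ b) (d : C) : (b ⟶ d) →L[𝕜] (a ⟶ d) :=
  LinearMap.mkContinuous
    { toFun := fun g => f ≫ g
      map_add' := NormedCategory.comp_add f
      map_smul' := fun r g => comp_smul r f g } ‖f‖ (NormedCategory.norm_comp_le f)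

/-- Postcomposition with a morphism. -/
def postcomp (a : C) {b d : C} (g : b ⟶ d) : (a ⟶ b) →L[𝕜] (a ⟶ d) :=
  LinearMap.mkContinuous
    { toFun := fun f => f ≫ g
      map_add' := fun f f' => NormedCategory.add_comp f f' g
      map_smul' := fun r f => smul_comp r f g } ‖g‖
    (fun f => (NormedCategory.norm_comp_le f g).trans_eq (mul_comm _ _))

@[simp]
theorem postcomp_apply (a : C) {b d : C} (g : b ⟶ d) (f : a ⟶ b) : postcomp 𝕜 a g f = f ≫ g := rfl

theorem norm_precomp_le {a b : C} (f : a ⟶ b) (d : C) : ‖precomp 𝕜 f d‖ ≤ ‖f‖ :=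
  LinearMap.mkContinuous_norm_le _ (norm_nonneg _) _

theorem norm_postcomp_le (a : C) {b d : C} (g : b ⟶ d) : ‖postcomp 𝕜 a g‖ ≤ ‖g‖ :=
  LinearMap.mkContinuous_norm_le _ (norm_nonneg _) _

end BanachCategory

open BanachCategory

section NormedCategory

variable {C : Type u} [Category.{v} C] [NormedCategory C]

theorem NormedCategory.norm_comp_le_of_le {a b c : C} {f : a ⟶ b} {g : b ⟶ c} {M N : ℝ}
    (hf : ‖f‖ ≤ M) (hg : ‖g‖ ≤ N) : ‖f ≫ g‖ ≤ M * N :=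
  (norm_comp_le f g).trans
    (mul_le_mul hf hg (norm_nonneg _) ((norm_nonneg _).trans hf))

end NormedCategory

namespace ContractiveFunctor

variable {𝕜 : Type*} [RCLike 𝕜]
  {A : Type u₁} [Category.{v} A] [NormedCategory A] [BanachCategory 𝕜 A]
  {B : Type u₂} [Category.{v} B] [NormedCategory B] [BanachCategory 𝕜 B]

variable (𝕜 A) in
/-- The identity functor. -/
def id : ContractiveFunctor 𝕜 A A where
  toFunctor := 𝟭 A
  map_add _ _ := rfl
  map_smul _ _ := rfl
  norm_map_le _ := le_rfl

theorem norm_mapCLM_le (T : ContractiveFunctor 𝕜 A B) (a b : A) : ‖T.mapCLM a b‖ ≤ 1 :=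
  LinearMap.mkContinuous_norm_le _ zero_le_one _

end ContractiveFunctor

/-! ### Morphisms of presheaves -/

namespace PShv

variable {𝕜 : Type v} [RCLike 𝕜] {A : Type v} [Category.{v} A] [NormedCategory A]
  [BanachCategory 𝕜 A] {ξ ζ χ : PShv 𝕜 A}

/-- The components of a morphism of presheaves. -/
def app (σ : ξ ⟶ ζ) (a : A) : ξ.val a →L[𝕜] ζ.val a := σ.1 a

/-- The morphism of presheaves with given components. -/
def homMk (f : ∀ a, ξ.val a →L[𝕜] ζ.val a) (M : ℝ) (hM : ∀ a, ‖f a‖ ≤ M)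
    (nat : ∀ (a b : A) (g : a ⟶ b) (x : ξ.val b), f a (ξ.res g x) = ζ.res g (f b x)) : ξ ⟶ ζ :=
  ⟨⟨f, memℓp_infty ⟨M, by rintro _ ⟨a, rfl⟩; exact hM a⟩⟩, nat⟩

theorem app_ext {σ τ : ξ ⟶ ζ} (h : ∀ a x, app σ a x = app τ a x) : σ = τ :=
  hom_ext fun a => ContinuousLinearMap.ext (h a)

theorem app_res (σ : ξ ⟶ ζ) {a b : A} (f : a ⟶ b) (x : ξ.val b) :
    app σ a (ξ.res f x) = ζ.res f (app σ b x) := σ.2 a b f x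

@[simp] theorem id_app (a : A) (x : ξ.val a) : app (𝟙 ξ) a x = x := rfl

@[simp] theorem comp_app (σ : ξ ⟶ ζ) (τ : ζ ⟶ χ) (a : A) (x : ξ.val a) :
    app (σ ≫ τ) a x = app τ a (app σ a x) := rfl

@[simp] theorem add_app (σ τ : ξ ⟶ ζ) (a : A) (x : ξ.val a) :
    app (σ + τ) a x = app σ a x + app τ a x := rfl

@[simp] theorem smul_app (r : 𝕜) (σ : ξ ⟶ ζ) (a : A) (x : ξ.val a) :
    app (r • σ) a x = r • app σ a x := rfl

theorem norm_app_le (σ : ξ ⟶ ζ) (a : A) : ‖app σ a‖ ≤ ‖σ‖ :=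
  lp.norm_apply_le_norm ENNReal.top_ne_zero σ.1 a

theorem norm_app_apply_le (σ : ξ ⟶ ζ) (a : A) (x : ξ.val a) : ‖app σ a x‖ ≤ ‖σ‖ * ‖x‖ :=
  ContinuousLinearMap.le_of_opNorm_le _ (norm_app_le σ a) x

theorem norm_le_of_forall_le {σ : ξ ⟶ ζ} {M : ℝ} (hM : 0 ≤ M) (h : ∀ a, ‖app σ a‖ ≤ M) :
    ‖σ‖ ≤ M :=
  lp.norm_le_of_forall_le hM h

theorem norm_homMk_le (f : ∀ a, ξ.val a →L[𝕜] ζ.val a) {M : ℝ} (hM : ∀ a, ‖f a‖ ≤ M)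
    (nat : ∀ (a b : A) (g : a ⟶ b) (x : ξ.val b), f a (ξ.res g x) = ζ.res g (f b x))
    (h0 : 0 ≤ M) : ‖homMk f M hM nat‖ ≤ M :=
  norm_le_of_forall_le h0 hM

@[simp] theorem res_id (a : A) (x : ξ.val a) : ξ.res (𝟙 a) x = x :=
  congrArg (fun f : ξ.val a →L[𝕜] ξ.val a => f x) (ξ.toFunctor.map_id (op a))

@[simp] theorem res_comp {a b c : A} (f : a ⟶ b) (g : b ⟶ c) (x : ξ.val c) :
    ξ.res (f ≫ g) x = ξ.res f (ξ.res g x) :=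
  congrArg (fun f : ξ.val c →L[𝕜] ξ.val a => f x) (ξ.toFunctor.map_comp g.op f.op)

@[simp] theorem res_add {a b : A} (f g : a ⟶ b) (x : ξ.val b) :
    ξ.res (f + g) x = ξ.res f x + ξ.res g x :=
  congrArg (fun f : ξ.val b →L[𝕜] ξ.val a => f x) (ξ.map_add f g)

@[simp] theorem res_smul {a b : A} (r : 𝕜) (f : a ⟶ b) (x : ξ.val b) :
    ξ.res (r • f) x = r • ξ.res f x :=
  congrArg (fun f : ξ.val b →L[𝕜] ξ.val a => f x) (ξ.map_smul r f)

theorem norm_res_apply_le {a b : A} (f : a ⟶ b) (x : ξ.val b) : ‖ξ.res f x‖ ≤ ‖f‖ * ‖x‖ :=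
  ContinuousLinearMap.le_of_opNorm_le _ (ξ.norm_map_le f) x

end PShv

/-! ### Weighted colimits -/

section Colimits

variable {𝕜 : Type v} [RCLike 𝕜]
  {K : Type v} [Category.{v} K] [NormedCategory K] [BanachCategory 𝕜 K]
  {C : Type u} [Category.{v} C] [NormedCategory C] [BanachCategory 𝕜 C]
  {W : PShv 𝕜 K} {F : ContractiveFunctor 𝕜 K C} {c d : C}

/-- Composition of a weighted cocone with a morphism out of its vertex. -/
def WeightedCocone.postcomp (φ : WeightedCocone W F c) (g : c ⟶ d) : WeightedCocone W F d where
  app k := (BanachCategory.postcomp 𝕜 (F.obj k) g).comp (φ.app k)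
  naturality {k l} f x := by
    simp [φ.naturality]

theorem WeightedCocone.norm_app_apply_le {φ : WeightedCocone W F c} {M : ℝ}
    (hφ : ∀ k, ‖φ.app k‖ ≤ M) (k : K) (x : W.val k) : ‖φ.app k x‖ ≤ M * ‖x‖ :=
  ContinuousLinearMap.le_of_opNorm_le _ (hφ k) x

theorem WeightedCocone.IsColimit.norm_postcomp_app_le {φ : WeightedCocone W F c}
    (hφ : φ.IsColimit) (g : c ⟶ d) (k : K) : ‖(φ.postcomp g).app k‖ ≤ ‖g‖ := by
  refine ContinuousLinearMap.opNorm_le_bound _ (norm_nonneg _) fun x => ?_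
  refine (NormedCategory.norm_comp_le_of_le
    (WeightedCocone.norm_app_apply_le hφ.contractive k x) le_rfl).trans_eq ?_
  ring

/-- Each `g` solves the universal problem posed by its own cocone with bound `‖g‖`. Uniqueness there
ranges over all morphisms, not just those within the bound, so `g'` may have a different norm. -/
theorem WeightedCocone.IsColimit.hom_ext {φ : WeightedCocone W F c} (hφ : φ.IsColimit)
    {g g' : c ⟶ d} (h : ∀ k x, φ.app k x ≫ g = φ.app k x ≫ g') : g = g' := by
  obtain ⟨_, -, -, hu⟩ := hφ.universal d (φ.postcomp g) ‖g‖ (norm_nonneg _)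
    (hφ.norm_postcomp_app_le g)
  exact (hu g fun _ _ => rfl).trans (hu g' fun k x => (h k x).symm).symm

variable {D : Type w} [Category.{v} D] [NormedCategory D] [BanachCategory 𝕜 D]

/-- A contractive functor `T` is cocontinuous if each functor `D(T -, d)` is isometrically
represented by some object. -/
theorem ContractiveFunctor.isCocontinuous_of_representable (T : ContractiveFunctor 𝕜 C D)
    (h : ∀ d : D, ∃ (r : C) (e : ∀ c, (T.obj c ⟶ d) →ₗ[𝕜] (c ⟶ r)),
      (∀ c g, ‖e c g‖ ≤ ‖g‖) ∧ (∀ c g g', e c g = e c g' → g = g') ∧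
      (∀ c f, ∃ g, ‖g‖ ≤ ‖f‖ ∧ e c g = f) ∧
      ∀ (c c' : C) (f : c ⟶ c') (g : T.obj c' ⟶ d), e c (T.map f ≫ g) = f ≫ e c' g) :
    T.IsCocontinuous := by
  intro K _ _ _ W F c φ hφ
  refine ⟨fun k => ?_, fun d ψ M hM hψ => ?_⟩
  · refine ContinuousLinearMap.opNorm_le_bound _ zero_le_one fun x => ?_
    exact (T.norm_map_le _).trans (WeightedCocone.norm_app_apply_le hφ.contractive k x)
  · obtain ⟨r, e, he, hinj, hsurj, hnat⟩ := h d
    let eL : ∀ c, (T.obj c ⟶ d) →L[𝕜] (c ⟶ r) := fun c =>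
      LinearMap.mkContinuous (e c) 1 (fun g => by simpa using he c g)
    -- A cocone under `T F` with vertex `d` becomes, through the representation `e`, a cocone under
    -- `F` with vertex `r`, where the universal property of `φ` applies.
    let ψ' : WeightedCocone W F r :=
      { app := fun k => (eL (F.obj k)).comp (ψ.app k)
        naturality := fun {k l} f x => by
          change e _ (ψ.app k (W.res f x)) = F.map f ≫ e _ (ψ.app l x)
          exact (congrArg (e _) (ψ.naturality f x)).trans (hnat _ _ _ _) }
    have hψ' : ∀ k, ‖ψ'.app k‖ ≤ M := fun k =>
      ContinuousLinearMap.opNorm_le_bound _ hM fun x =>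
        (he _ _).trans (WeightedCocone.norm_app_apply_le hψ k x)
    obtain ⟨f, hf, hf', hu⟩ := hφ.universal r ψ' M hM hψ'
    obtain ⟨g, hg, hgf⟩ := hsurj c f
    refine ⟨g, hg.trans hf, fun k x => hinj _ _ _ ?_, fun g' hg' => hinj _ _ _ ?_⟩
    · change e _ (T.map _ ≫ g) = _
      rw [hnat, hgf]
      exact hf' k x
    · rw [hgf]
      refine hu _ fun k x => ?_
      rw [← hnat]
      exact congrArg (e _) (hg' k x)

theorem ContractiveFunctor.IsCocontinuous.comp {E : Type u₁} [Category.{v} E] [NormedCategory E]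
    [BanachCategory 𝕜 E] {S : ContractiveFunctor 𝕜 C D} {T : ContractiveFunctor 𝕜 D E}
    (hS : S.IsCocontinuous) (hT : T.IsCocontinuous) : (S.comp T).IsCocontinuous :=
  fun K _ _ _ W F c φ hφ => hT K W (F.comp S) _ _ (hS K W F c φ hφ)

theorem ContractiveFunctor.isCocontinuous_id : (ContractiveFunctor.id 𝕜 C).IsCocontinuous :=
  fun _ _ _ _ _ _ _ _ hφ => hφ

end Colimits

/-! ### Representable presheaves -/

namespace PShv

variable {𝕜 : Type v} [RCLike 𝕜] {A : Type v} [Category.{v} A] [NormedCategory A]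
  [BanachCategory 𝕜 A]
  {C : Type u} [Category.{v} C] [NormedCategory C] [BanachCategory 𝕜 C]

/-- The presheaf `C(F -, d)`. -/
def homPresheaf (F : ContractiveFunctor 𝕜 A C) (d : C) : PShv 𝕜 A where
  toFunctor :=
    { obj := fun a => ⟨F.obj a.unop ⟶ d⟩
      map := fun f => precomp 𝕜 (F.map f.unop) d
      map_id := fun a => ContinuousLinearMap.ext fun g => by
        change F.map (𝟙 a.unop) ≫ g = g
        simp
      map_comp := fun f f' => ContinuousLinearMap.ext fun g => by
        change F.map (f'.unop ≫ f.unop) ≫ g = F.map f'.unop ≫ F.map f.unop ≫ g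
        simp }
  map_add f f' := ContinuousLinearMap.ext fun g => by
    change F.map (f + f') ≫ g = F.map f ≫ g + F.map f' ≫ g
    rw [F.map_add, NormedCategory.add_comp]
  map_smul r f := ContinuousLinearMap.ext fun g => by
    change F.map (r • f) ≫ g = r • (F.map f ≫ g)
    rw [F.map_smul, BanachCategory.smul_comp]
  norm_map_le f := (norm_precomp_le 𝕜 (F.map f) d).trans (F.norm_map_le f)

variable (𝕜 A) in
/-- The Yoneda embedding. -/
def yoneda : ContractiveFunctor 𝕜 A (PShv 𝕜 A) where
  obj a := homPresheaf (ContractiveFunctor.id 𝕜 A) a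
  map f := homMk (fun b => BanachCategory.postcomp 𝕜 b f) ‖f‖
    (fun b => norm_postcomp_le 𝕜 b f) (fun _ _ g x => Category.assoc g x f)
  map_id _ := app_ext fun b x => Category.comp_id (X := b) x
  map_comp f g := app_ext fun b x => (Category.assoc (W := b) x f g).symm
  map_add f g := app_ext fun b x => NormedCategory.comp_add (a := b) x f g
  map_smul r f := app_ext fun b x => BanachCategory.comp_smul (a := b) r x f
  norm_map_le f := norm_homMk_le _ _ _ (norm_nonneg f)

/-- The morphism from a representable presheaf which is determined by an element. -/
def ofElement (ξ : PShv 𝕜 A) {a : A} (x : ξ.val a) : (yoneda 𝕜 A).obj a ⟶ ξ :=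
  homMk (fun b => LinearMap.mkContinuous
    { toFun := fun f : b ⟶ a => ξ.res f x
      map_add' := fun f g => res_add f g x
      map_smul' := fun r f => res_smul r f x } ‖x‖
      (fun f => (norm_res_apply_le f x).trans_eq (mul_comm _ _))) ‖x‖
    (fun _ => LinearMap.mkContinuous_norm_le _ (norm_nonneg x) _)
    (fun _ _ g f => res_comp (ξ := ξ) g f x)

theorem norm_ofElement_le (ξ : PShv 𝕜 A) {a : A} (x : ξ.val a) : ‖ofElement ξ x‖ ≤ ‖x‖ :=
  norm_homMk_le _ _ _ (norm_nonneg x)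

theorem ofElement_comp {ξ ζ : PShv 𝕜 A} {a : A} (x : ξ.val a) (σ : ξ ⟶ ζ) :
    ofElement ξ x ≫ σ = ofElement ζ (app σ a x) :=
  app_ext fun b f => app_res σ (show b ⟶ a from f) x

theorem ofElement_yoneda {a b : A} (f : b ⟶ a) :
    ofElement ((yoneda 𝕜 A).obj a) f = (yoneda 𝕜 A).map f :=
  app_ext fun _ _ => rfl

/-- The canonical presentation of a presheaf as a weighted colimit of representable presheaves. -/
noncomputable def density (ξ : PShv 𝕜 A) : WeightedCocone ξ (yoneda 𝕜 A) ξ where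
  app a := LinearMap.mkContinuous
    { toFun := fun x => ofElement ξ x
      map_add' := fun x y => app_ext fun b f => _root_.map_add (ξ.res (show b ⟶ a from f)) x y
      map_smul' := fun r x => app_ext fun b f => _root_.map_smul (ξ.res (show b ⟶ a from f)) r x } 1
    (fun x => by simpa using norm_ofElement_le ξ x)
  naturality {a b} f x := app_ext fun c g =>
    (res_comp (ξ := ξ) (show c ⟶ a from g) f x).symm

/-- Co-Yoneda: a cocone `ψ` assigns to `x` in `ξ(a)` a morphism out of the representable at `a`,
which is the same as an element of `ζ(a)`, namely its value at the identity. These elements assemble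
to the required morphism `ξ ⟶ ζ`. -/
theorem density_isColimit (ξ : PShv 𝕜 A) : (density ξ).IsColimit where
  contractive a := ContinuousLinearMap.opNorm_le_bound _ zero_le_one fun x =>
    (norm_ofElement_le ξ x).trans_eq (one_mul _).symm
  universal ζ ψ M hM hψ := by
    have hn : ∀ a x, ‖app (ψ.app a x) a (𝟙 a)‖ ≤ M * ‖x‖ := fun a x => by
      refine (norm_app_apply_le _ _ _).trans ?_
      exact (mul_le_of_le_one_right (norm_nonneg _) (NormedCategory.norm_id_le a)).trans
        (WeightedCocone.norm_app_apply_le hψ a x)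
    -- Naturality of `ψ` makes the values at identities determine all values; this gives both the
    -- naturality of the assembled morphism and its compatibility with `ψ`.
    have key : ∀ {a b : A} (f : b ⟶ a) (x : ξ.val a),
        app (ψ.app b (ξ.res f x)) b (𝟙 b) = app (ψ.app a x) b f := fun {a b} f x => by
      rw [ψ.naturality]
      exact congrArg (app (ψ.app a x) b) (Category.id_comp f)
    refine ⟨homMk (fun a => LinearMap.mkContinuous
      { toFun := fun x => app (ψ.app a x) a (𝟙 a)
        map_add' := fun x y => by rw [_root_.map_add]; rfl
        map_smul' := fun r x => by rw [_root_.map_smul]; rfl } M (hn a)) M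
      (fun a => LinearMap.mkContinuous_norm_le _ hM _) (fun b a f x => ?_),
      norm_homMk_le _ _ _ hM, fun a x => ?_, fun g' hg' => ?_⟩
    · refine (key f x).trans ?_
      refine Eq.trans ?_ (app_res (ψ.app a x) f (𝟙 a))
      exact congrArg _ (Category.comp_id f).symm
    · exact app_ext fun b f => key f x
    · refine app_ext fun a x => ?_
      have := congrArg (fun σ : (yoneda 𝕜 A).obj a ⟶ ζ => app σ a (show a ⟶ a from 𝟙 a)) (hg' a x)
      refine Eq.trans ?_ this
      exact congrArg (app g' a) (res_id a x).symm

/-! ### Transformations determined by representable presheaves -/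

section Extension

variable {S T : ContractiveFunctor 𝕜 (PShv 𝕜 A) C}

/-- `S` preserves the density colimit, so the morphisms `S.map (ofElement ξ x)` are jointly
epimorphic, and naturality along them reduces the component at `ξ` to those at representables. -/
theorem natTrans_ext (hS : S.IsCocontinuous) {τ τ' : S.toFunctor ⟶ T.toFunctor}
    (h : ∀ a, τ.app ((yoneda 𝕜 A).obj a) = τ'.app ((yoneda 𝕜 A).obj a)) : τ = τ' := by
  ext ξ
  refine (hS A ξ _ _ _ (density_isColimit ξ)).hom_ext fun a x => ?_
  change S.map (ofElement ξ x) ≫ _ = S.map (ofElement ξ x) ≫ _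
  rw [τ.naturality, τ'.naturality, h]

/-- A bounded natural transformation between the restrictions of two functors to representable
presheaves extends to all presheaves, provided that the first functor is cocontinuous. -/
theorem exists_natTrans_extension (hS : S.IsCocontinuous) (T : ContractiveFunctor 𝕜 (PShv 𝕜 A) C)
    (σ : ∀ a, S.obj ((yoneda 𝕜 A).obj a) ⟶ T.obj ((yoneda 𝕜 A).obj a))
    (nat : ∀ {a b : A} (f : a ⟶ b),
      S.map ((yoneda 𝕜 A).map f) ≫ σ b = σ a ≫ T.map ((yoneda 𝕜 A).map f))
    {M : ℝ} (hM : 0 ≤ M) (hσ : ∀ a, ‖σ a‖ ≤ M) :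
    ∃ τ : S.toFunctor ⟶ T.toFunctor, NatTransBoundedBy τ M ∧
      ∀ a, τ.app ((yoneda 𝕜 A).obj a) = σ a := by
  have hc := fun ξ => hS A ξ _ _ _ (density_isColimit ξ)
  -- An element `x` of `ξ(a)` is sent to `σ a` followed by `T` of the morphism classified by `x`;
  -- `nat` makes this a cocone, and the density colimit preserved by `S` factors it.
  let ψ : ∀ ξ : PShv 𝕜 A, WeightedCocone ξ ((yoneda 𝕜 A).comp S) (T.obj ξ) := fun ξ =>
    { app := fun a => (precomp 𝕜 (σ a) (T.obj ξ)).comp (((density ξ).mapCocone T).app a)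
      naturality := fun {a b} f x => by
        change σ a ≫ T.map ((density ξ).app a (ξ.res f x)) =
          S.map ((yoneda 𝕜 A).map f) ≫ σ b ≫ T.map ((density ξ).app b x)
        rw [(density ξ).naturality, T.map_comp, ← Category.assoc, ← nat, Category.assoc] }
  have hψ : ∀ ξ a, ‖(ψ ξ).app a‖ ≤ M := fun ξ a =>
    ContinuousLinearMap.opNorm_le_bound _ hM fun x =>
      NormedCategory.norm_comp_le_of_le (hσ a)
        ((T.norm_map_le _).trans (norm_ofElement_le ξ x))
  choose t ht ht' _ using fun ξ => (hc ξ).universal (T.obj ξ) (ψ ξ) M hM (hψ ξ)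
  have ht'' : ∀ ξ a (x : ξ.val a), S.map (ofElement ξ x) ≫ t ξ = σ a ≫ T.map (ofElement ξ x) := ht'
  refine ⟨{ app := t, naturality := fun ξ ζ f => (hc ξ).hom_ext fun a x => ?_ }, ht, fun a => ?_⟩
  · change S.map (ofElement ξ x) ≫ S.map f ≫ t ζ = S.map (ofElement ξ x) ≫ t ξ ≫ T.map f
    rw [← Category.assoc, ← Category.assoc, ht'', ← S.map_comp, Category.assoc, ← T.map_comp,
      ofElement_comp, ht'']
  -- The element `𝟙 a` of the representable at `a` classifies its identity morphism.
  · have := ht'' ((yoneda 𝕜 A).obj a) a (𝟙 a)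
    rw [ofElement_yoneda, (yoneda 𝕜 A).map_id, S.map_id, T.map_id] at this
    simpa using this

end Extension

/-! ### The cocontinuous extension of a functor along the Yoneda embedding -/

section Lan

variable (hC : IsBanachTwoSpace 𝕜 C) (F : ContractiveFunctor 𝕜 A C)

/-- The `ξ`-weighted colimit of `F`. -/
noncomputable def lanObj (ξ : PShv 𝕜 A) : C := (hC A ξ F).choose

/-- The universal cocone over `F` with weight `ξ`. -/
noncomputable def lanCocone (ξ : PShv 𝕜 A) : WeightedCocone ξ F (lanObj hC F ξ) :=
  (hC A ξ F).choose_spec.choose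

theorem lanCocone_isColimit (ξ : PShv 𝕜 A) : (lanCocone hC F ξ).IsColimit :=
  (hC A ξ F).choose_spec.choose_spec

/-- Weighted colimits are functorial in the weight: restricting the cocone of `ζ` along `f`
multiplies its bound by at most `‖f‖`. -/
theorem exists_lanMap {ξ ζ : PShv 𝕜 A} (f : ξ ⟶ ζ) :
    ∃ g : lanObj hC F ξ ⟶ lanObj hC F ζ, ‖g‖ ≤ ‖f‖ ∧
      ∀ a x, (lanCocone hC F ξ).app a x ≫ g = (lanCocone hC F ζ).app a (app f a x) := by
  let ψ : WeightedCocone ξ F (lanObj hC F ζ) :=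
    { app := fun a => ((lanCocone hC F ζ).app a).comp (app f a)
      naturality := fun {a b} g x => by
        change (lanCocone hC F ζ).app a (app f a (ξ.res g x)) = _
        rw [app_res, (lanCocone hC F ζ).naturality]
        rfl }
  obtain ⟨g, hg, hg', -⟩ := (lanCocone_isColimit hC F ξ).universal _ ψ ‖f‖ (norm_nonneg f)
    (fun a => ContinuousLinearMap.opNorm_le_bound _ (norm_nonneg f) fun x =>
      (WeightedCocone.norm_app_apply_le (lanCocone_isColimit hC F ζ).contractive a _).trans
        (by simpa using norm_app_apply_le f a x))
  exact ⟨g, hg, hg'⟩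

/-- The action of the cocontinuous extension on morphisms. -/
noncomputable def lanMap {ξ ζ : PShv 𝕜 A} (f : ξ ⟶ ζ) : lanObj hC F ξ ⟶ lanObj hC F ζ :=
  (exists_lanMap hC F f).choose

theorem norm_lanMap_le {ξ ζ : PShv 𝕜 A} (f : ξ ⟶ ζ) : ‖lanMap hC F f‖ ≤ ‖f‖ :=
  (exists_lanMap hC F f).choose_spec.1

theorem lanCocone_comp_lanMap {ξ ζ : PShv 𝕜 A} (f : ξ ⟶ ζ) (a : A) (x : ξ.val a) :
    (lanCocone hC F ξ).app a x ≫ lanMap hC F f = (lanCocone hC F ζ).app a (app f a x) :=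
  (exists_lanMap hC F f).choose_spec.2 a x

/-- The cocontinuous extension of `F` along the Yoneda embedding. -/
noncomputable def lan : ContractiveFunctor 𝕜 (PShv 𝕜 A) C where
  obj := lanObj hC F
  map f := lanMap hC F f
  map_id ξ := (lanCocone_isColimit hC F ξ).hom_ext fun a x => by
    rw [lanCocone_comp_lanMap, Category.comp_id, id_app]
  map_comp f g := (lanCocone_isColimit hC F _).hom_ext fun a x => by
    rw [lanCocone_comp_lanMap, ← Category.assoc, lanCocone_comp_lanMap, lanCocone_comp_lanMap,
      comp_app]
  map_add f g := (lanCocone_isColimit hC F _).hom_ext fun a x => by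
    rw [lanCocone_comp_lanMap, NormedCategory.comp_add, lanCocone_comp_lanMap,
      lanCocone_comp_lanMap, add_app, _root_.map_add]
  map_smul r f := (lanCocone_isColimit hC F _).hom_ext fun a x => by
    rw [lanCocone_comp_lanMap, BanachCategory.comp_smul, lanCocone_comp_lanMap, smul_app,
      _root_.map_smul]
  norm_map_le f := norm_lanMap_le hC F f

/-- The universal property of the weighted colimit says that morphisms from `lan ξ` to `d` are,
isometrically, morphisms from `ξ` to the presheaf `C(F -, d)`. Thus `homPresheaf F` supplies a right
adjoint. -/
theorem lan_isCocontinuous : (lan hC F).IsCocontinuous := by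
  refine ContractiveFunctor.isCocontinuous_of_representable _ fun d =>
    ⟨homPresheaf F d, fun ξ =>
      { toFun := fun g => homMk (ζ := homPresheaf F d)
          (((lanCocone hC F ξ).postcomp (show lanObj hC F ξ ⟶ d from g)).app) ‖g‖
          ((lanCocone_isColimit hC F ξ).norm_postcomp_app_le g)
          (fun a b f x =>
            ((lanCocone hC F ξ).postcomp (show lanObj hC F ξ ⟶ d from g)).naturality f x)
        map_add' := fun g g' => app_ext fun a x => NormedCategory.comp_add _ g g'
        map_smul' := fun r g => app_ext fun a x => BanachCategory.comp_smul r _ g }, ?_, ?_, ?_, ?_⟩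
  · exact fun ξ g => norm_le_of_forall_le (norm_nonneg g)
      ((lanCocone_isColimit hC F ξ).norm_postcomp_app_le g)
  · exact fun ξ g g' h => (lanCocone_isColimit hC F ξ).hom_ext fun a x =>
      congrArg (fun σ => app σ a x) h
  · intro ξ f
    let ψ : WeightedCocone ξ F d := ⟨fun a => app f a, fun g x => app_res f g x⟩
    obtain ⟨g, hg, hg', -⟩ := (lanCocone_isColimit hC F ξ).universal d ψ ‖f‖ (norm_nonneg f)
      (norm_app_le f)
    exact ⟨g, hg, app_ext hg'⟩
  · intro ξ ζ f g
    refine app_ext fun a x => ?_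
    change (lanCocone hC F ξ).app a x ≫ lanMap hC F f ≫ g =
      (lanCocone hC F ζ).app a (app f a x) ≫ g
    rw [← lanCocone_comp_lanMap]
    exact (Category.assoc _ _ _).symm

/-- The extension of `F` restricts to `F` on representable presheaves. -/
theorem exists_lan_yoneda_iso (a : A) :
    ∃ e : (lan hC F).obj ((yoneda 𝕜 A).obj a) ≅ F.obj a, ‖e.hom‖ ≤ 1 ∧ ‖e.inv‖ ≤ 1 := by
  have hc := lanCocone_isColimit hC F ((yoneda 𝕜 A).obj a)
  let κ := lanCocone hC F ((yoneda 𝕜 A).obj a)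
  let ψ : WeightedCocone ((yoneda 𝕜 A).obj a) F (F.obj a) :=
    { app := fun b => F.mapCLM b a
      naturality := fun {b c} f x => F.map_comp f x }
  obtain ⟨g, hg, hg', -⟩ := hc.universal _ ψ 1 zero_le_one fun b => F.norm_mapCLM_le b a
  have hg1 : ∀ b (f : b ⟶ a), κ.app b f ≫ g = F.map f := hg'
  -- Yoneda: a cocone weighted by a representable is determined by its value at the identity. This
  -- value is the inverse of `g`.
  have hκ : ∀ b (f : b ⟶ a), κ.app b f = F.map f ≫ κ.app a (𝟙 a) := fun b f => by
    refine Eq.trans ?_ (κ.naturality f (𝟙 a))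
    exact congrArg (κ.app b) (Category.comp_id f).symm
  refine ⟨⟨g, κ.app a (𝟙 a), hc.hom_ext fun b f => ?_, ?_⟩, hg, ?_⟩
  · change κ.app b f ≫ g ≫ κ.app a (𝟙 a) = κ.app b f ≫ 𝟙 _
    rw [← Category.assoc]
    exact ((congrArg (· ≫ κ.app a (𝟙 a)) (hg1 b f)).trans (hκ b f).symm).trans
      (Category.comp_id _).symm
  · exact (hg1 a (𝟙 a)).trans (F.map_id a)
  · exact (WeightedCocone.norm_app_apply_le hc.contractive a (𝟙 a)).trans
      ((one_mul _).trans_le (NormedCategory.norm_id_le a))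

end Lan

end PShv

/-! ### Zero morphisms -/

theorem NormedCategory.zero_comp {C : Type u} [Category.{v} C] [NormedCategory C] {a b c : C}
    (g : b ⟶ c) : (0 : a ⟶ b) ≫ g = 0 := by
  have := NormedCategory.add_comp (0 : a ⟶ b) 0 g
  simpa using this

theorem NormedCategory.comp_zero {C : Type u} [Category.{v} C] [NormedCategory C] {a b c : C}
    (f : a ⟶ b) : f ≫ (0 : b ⟶ c) = 0 := by
  have := NormedCategory.comp_add f (0 : b ⟶ c) 0
  simpa using this

theorem ContractiveFunctor.map_zero {𝕜 : Type*} [RCLike 𝕜]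
    {A : Type u₁} [Category.{v} A] [NormedCategory A] [BanachCategory 𝕜 A]
    {B : Type u₂} [Category.{v} B] [NormedCategory B] [BanachCategory 𝕜 B]
    (T : ContractiveFunctor 𝕜 A B) (a b : A) : T.map (0 : a ⟶ b) = 0 :=
  _root_.map_zero (T.mapCLM a b)

/-! ### Functors and presheaves on sets -/

namespace FreeBanachCategory

variable {𝕜 : Type v} [RCLike 𝕜] {X : Type v}

/-- Off-diagonal hom-spaces vanish and diagonal ones are spanned by the identity, so these two cases
exhaust all morphisms. -/
theorem hom_induction {P : ∀ {x y : FreeBanachCategory 𝕜 X}, (x ⟶ y) → Prop}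
    (zero : ∀ x y : FreeBanachCategory 𝕜 X, P (0 : x ⟶ y))
    (smul_id : ∀ (x : FreeBanachCategory 𝕜 X) (r : 𝕜), P (r • 𝟙 x))
    {x y : FreeBanachCategory 𝕜 X} (f : x ⟶ y) : P f := by
  obtain ⟨x⟩ := x
  obtain ⟨y⟩ := y
  by_cases h : x = y
  · subst h
    have : f = f.1 • 𝟙 (⟨x⟩ : FreeBanachCategory 𝕜 X) := Subtype.ext (mul_one f.1).symm
    rw [this]
    exact smul_id _ _
  · have : f = 0 := Subtype.ext (f.2 h)
    rw [this]
    exact zero _ _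

variable {C : Type u} [Category.{v} C] [NormedCategory C] [BanachCategory 𝕜 C]

variable (𝕜) in
/-- The contractive functor on the free Banach category which is determined by its values on
objects. -/
noncomputable def lift (obj : X → C) : ContractiveFunctor 𝕜 (FreeBanachCategory 𝕜 X) C where
  obj x := obj x.as
  map {x y} f := by
    classical
    exact if h : x.as = y.as then f.1 • eqToHom (congrArg obj h) else 0
  map_id x := by
    rw [dif_pos rfl]
    exact one_smul 𝕜 (𝟙 (obj x.as))
  map_comp {x y z} f g := by
    obtain ⟨x⟩ := x
    obtain ⟨y⟩ := y
    obtain ⟨z⟩ := z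
    by_cases hxy : x = y
    · subst hxy
      by_cases hxz : x = z
      · subst hxz
        simp only [dif_pos, eqToHom_refl, BanachCategory.comp_smul, Category.comp_id, smul_smul]
        congr 1
        exact mul_comm f.1 g.1
      · simp [hxz, NormedCategory.comp_zero]
    · have hf : (f ≫ g).1 = 0 := by
        change f.1 * g.1 = 0
        rw [f.2 hxy, zero_mul]
      simp [hxy, hf, NormedCategory.zero_comp]
  map_add {x y} f g := by
    by_cases h : x.as = y.as
    · simp only [dif_pos h, ← add_smul]
      rfl
    · simp [h]
  map_smul {x y} r f := by
    by_cases h : x.as = y.as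
    · simp only [dif_pos h, smul_smul]
      rfl
    · simp [h]
  norm_map_le {x y} f := by
    obtain ⟨x⟩ := x
    obtain ⟨y⟩ := y
    by_cases h : x = y
    · subst h
      simp only [dif_pos, eqToHom_refl, norm_smul]
      exact mul_le_of_le_one_right (norm_nonneg f.1) (NormedCategory.norm_id_le _)
    · simp [h]

/-- Naturality is automatic for families indexed by a set. -/
theorem naturality (S T : ContractiveFunctor 𝕜 (FreeBanachCategory 𝕜 X) C)
    (σ : ∀ x, S.obj x ⟶ T.obj x) {x y : FreeBanachCategory 𝕜 X} (f : x ⟶ y) :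
    S.map f ≫ σ y = σ x ≫ T.map f := by
  refine hom_induction (P := fun {x y} f => S.map f ≫ σ y = σ x ≫ T.map f) ?_ ?_ f
  · intro x y
    rw [S.map_zero, T.map_zero, NormedCategory.zero_comp, NormedCategory.comp_zero]
  · intro x r
    rw [S.map_smul, T.map_smul, BanachCategory.smul_comp, BanachCategory.comp_smul, S.map_id,
      T.map_id, Category.id_comp, Category.comp_id]

end FreeBanachCategory

/-! ### Presheaves on a set as families of Banach spaces -/

namespace PShvSet

variable {𝕜 : Type v} [RCLike 𝕜] {X : Type v}

/-- The presheaf on a set which is given by a family of Banach spaces. -/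
noncomputable def ofFamily (E : X → Ban 𝕜) : PShvSet 𝕜 X where
  toFunctor :=
    -- The value at a point is definitionally the given member of the family, so components of
    -- morphisms can be written without transport; `eqToHom` occurs only in the restriction maps.
    { obj := fun x => E x.unop.as
      map := fun {x y} f => by
        classical
        exact if h : x.unop.as = y.unop.as then f.unop.1 • eqToHom (congrArg E h) else 0
      map_id := fun x => by
        rw [dif_pos rfl]
        exact one_smul 𝕜 (𝟙 (E x.unop.as))
      map_comp := fun {x y z} f g => by
        obtain ⟨⟨x⟩⟩ := x
        obtain ⟨⟨y⟩⟩ := y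
        obtain ⟨⟨z⟩⟩ := z
        by_cases hxy : x = y
        · subst hxy
          by_cases hxz : x = z
          · subst hxz
            simp only [dif_pos, eqToHom_refl, BanachCategory.comp_smul, Category.comp_id,
              smul_smul]
            rfl
          · simp [hxz, NormedCategory.comp_zero]
        · have hf : (f ≫ g).unop.1 = 0 := by
            change g.unop.1 * f.unop.1 = 0
            rw [f.unop.2 (Ne.symm hxy), mul_zero]
          simp only [hf, zero_smul, dite_eq_ite, ite_self, hxy, dif_neg, not_false_eq_true,
            NormedCategory.zero_comp] }
  map_add {x y} f g := by
    by_cases h : y.as = x.as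
    · simp only [dif_pos h, ← add_smul]
      rfl
    · simp [h]
  map_smul {x y} r f := by
    by_cases h : y.as = x.as
    · simp only [dif_pos h, smul_smul]
      rfl
    · simp [h]
  norm_map_le {x y} f := by
    obtain ⟨x⟩ := x
    obtain ⟨y⟩ := y
    by_cases h : y = x
    · subst h
      simp only [dif_pos, eqToHom_refl, norm_smul]
      exact mul_le_of_le_one_right (norm_nonneg f.1) (NormedCategory.norm_id_le _)
    · simp [h]

open PShv

/-- A morphism of presheaves on a set is a bounded family of bounded linear maps. -/
noncomputable def homMk {ξ ζ : PShvSet 𝕜 X} (f : ∀ x, ξ.val x →L[𝕜] ζ.val x) (M : ℝ)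
    (hM : ∀ x, ‖f x‖ ≤ M) :
    ξ ⟶ ζ :=
  PShv.homMk f M hM fun a b g => by
    refine FreeBanachCategory.hom_induction
      (P := fun {a b} g => ∀ x, f a (ξ.res g x) = ζ.res g (f b x)) ?_ ?_ g
    · intro a b x
      have h : ∀ (χ : PShvSet 𝕜 X) (y : χ.val b), χ.res (0 : a ⟶ b) y = 0 := fun χ y => by
        have := res_smul (ξ := χ) (0 : 𝕜) (0 : a ⟶ b) y
        rwa [zero_smul, zero_smul] at this
      rw [h, h, _root_.map_zero]
    · intro a r x
      rw [res_smul, res_smul, res_id, res_id, _root_.map_smul]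

theorem norm_homMk_le {ξ ζ : PShvSet 𝕜 X} (f : ∀ x, ξ.val x →L[𝕜] ζ.val x) {M : ℝ}
    (hM : ∀ x, ‖f x‖ ≤ M) (h0 : 0 ≤ M) : ‖homMk f M hM‖ ≤ M :=
  norm_le_of_forall_le h0 hM

section HomMkL

variable {V : Type*} [NormedAddCommGroup V] [NormedSpace 𝕜 V] {ξ ζ : PShvSet 𝕜 X}
  (B : ∀ x, V →L[𝕜] ξ.val x →L[𝕜] ζ.val x) {M : ℝ} (h0 : 0 ≤ M) (hM : ∀ x, ‖B x‖ ≤ M)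

/-- A bounded linear map into a space of morphisms of presheaves on a set. -/
noncomputable def homMkL : V →L[𝕜] (ξ ⟶ ζ) :=
  have h : ∀ (w : V) (x), ‖B x w‖ ≤ M * ‖w‖ := fun w x =>
    ContinuousLinearMap.le_of_opNorm_le _ (hM x) w
  LinearMap.mkContinuous
    { toFun := fun w => homMk (fun x => B x w) (M * ‖w‖) (h w)
      map_add' := fun w w' => app_ext fun x t =>
        congrArg (fun f => f t) (_root_.map_add (B x) w w')
      map_smul' := fun r w => app_ext fun x t =>
        congrArg (fun f => f t) (_root_.map_smul (B x) r w) } M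
    (fun w => norm_homMk_le _ (h w) (mul_nonneg h0 (norm_nonneg w)))

theorem norm_homMkL_le : ‖homMkL B h0 hM‖ ≤ M :=
  ContinuousLinearMap.opNorm_le_bound _ h0 fun w =>
    norm_le_of_forall_le (mul_nonneg h0 (norm_nonneg w)) fun x =>
      ContinuousLinearMap.le_of_opNorm_le _ (hM x) w

end HomMkL

end PShvSet

namespace PShv

variable {𝕜 : Type v} [RCLike 𝕜] {A : Type v} [Category.{v} A] [NormedCategory A]
  [BanachCategory 𝕜 A]

/-- Evaluation of morphisms of presheaves at an object. -/
noncomputable def appL (ξ ζ : PShv 𝕜 A) (a : A) : (ξ ⟶ ζ) →L[𝕜] (ξ.val a →L[𝕜] ζ.val a) :=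
  LinearMap.mkContinuous
    { toFun := fun σ => app σ a
      map_add' := fun _ _ => rfl
      map_smul' := fun _ _ => rfl } 1 (fun σ => (norm_app_le σ a).trans_eq (one_mul _).symm)

end PShv

/-! ### Cocompleteness of presheaves on a set -/

namespace PShvSet

open PShv

variable {𝕜 : Type v} [RCLike 𝕜] {X : Type v}
  {K : Type v} [Category.{v} K] [NormedCategory K] [BanachCategory 𝕜 K]
  (W : PShv 𝕜 K) (F : ContractiveFunctor 𝕜 K (PShvSet 𝕜 X))

/-- The bounded scalar valued cocones over the values of `F` at `x`. -/
def scalarCocones (x : FreeBanachCategory 𝕜 X) :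
    Submodule 𝕜 (lp (fun k : K => W.val k →L[𝕜] (F.obj k).val x →L[𝕜] 𝕜) ∞) where
  carrier := {n | ∀ (k l : K) (f : k ⟶ l) (w : W.val l) (t : (F.obj k).val x),
    n k (W.res f w) t = n l w (app (F.map f) x t)}
  add_mem' {m n} hm hn k l f w t := by simp [hm k l f w t, hn k l f w t]
  zero_mem' k l f w t := by simp
  smul_mem' r n hn k l f w t := by simp [hn k l f w t]

/-- Evaluation of scalar valued cocones. -/
noncomputable def coconeEval (x : FreeBanachCategory 𝕜 X)
    (s : Σ k, W.val k × (F.obj k).val x) : scalarCocones W F x →L[𝕜] 𝕜 :=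
  LinearMap.mkContinuous
    { toFun := fun n => n.1 s.1 s.2.1 s.2.2
      map_add' := fun m n => by simp
      map_smul' := fun r n => by simp } (‖s.2.1‖ * ‖s.2.2‖) (fun n => by
    refine (ContinuousLinearMap.le_opNorm₂ (n.1 s.1) s.2.1 s.2.2).trans ?_
    rw [mul_assoc, mul_comm]
    exact mul_le_mul_of_nonneg_left (lp.norm_apply_le_norm ENNReal.top_ne_zero n.1 s.1)
      (by positivity))

theorem norm_coconeEval_le (x : FreeBanachCategory 𝕜 X) (s : Σ k, W.val k × (F.obj k).val x) :
    ‖coconeEval W F x s‖ ≤ ‖s.2.1‖ * ‖s.2.2‖ :=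
  LinearMap.mkContinuous_norm_le _ (by positivity) _

/-- The value of the weighted colimit at a point. -/
noncomputable def colimitVal (x : FreeBanachCategory 𝕜 X) : Ban 𝕜 where
  carrier := closedSpan 𝕜 (coconeEval W F x)

variable {W F} in
theorem colimitVal_hom_ext {x : FreeBanachCategory 𝕜 X} {G : Type v} [NormedAddCommGroup G]
    [NormedSpace 𝕜 G] {g g' : colimitVal W F x →L[𝕜] G}
    (h : ∀ s, g (closedSpan.gen 𝕜 (coconeEval W F x) s) =
      g' (closedSpan.gen 𝕜 (coconeEval W F x) s)) : g = g' :=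
  closedSpan.hom_ext h

/-- The pointwise weighted colimit. -/
noncomputable def colimitObj : PShvSet 𝕜 X :=
  ofFamily fun x => colimitVal W F ⟨x⟩

/-- The value of the universal cocone at a point. -/
noncomputable def colimitLeg (k : K) (x : FreeBanachCategory 𝕜 X) :
    W.val k →L[𝕜] (F.obj k).val x →L[𝕜] colimitVal W F x :=
  LinearMap.mkContinuous₂ (LinearMap.mk₂ 𝕜
    (fun w t => (closedSpan.gen 𝕜 (coconeEval W F x) ⟨k, w, t⟩ : colimitVal W F x))
    (fun w w' t => Subtype.ext (ContinuousLinearMap.ext fun n =>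
      show n.1 k (w + w') t = n.1 k w t + n.1 k w' t by simp))
    (fun r w t => Subtype.ext (ContinuousLinearMap.ext fun n =>
      show n.1 k (r • w) t = r • n.1 k w t by simp))
    (fun w t t' => Subtype.ext (ContinuousLinearMap.ext fun n =>
      show n.1 k w (t + t') = n.1 k w t + n.1 k w t' by simp))
    (fun r w t => Subtype.ext (ContinuousLinearMap.ext fun n =>
      show n.1 k w (r • t) = r • n.1 k w t by simp))) 1 (fun w t =>
    (norm_coconeEval_le W F x ⟨k, w, t⟩).trans_eq (by rw [one_mul]))

theorem norm_colimitLeg_le (k : K) (x : FreeBanachCategory 𝕜 X) : ‖colimitLeg W F k x‖ ≤ 1 :=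
  LinearMap.mkContinuous₂_norm_le _ zero_le_one _

theorem colimitLeg_res {k l : K} (f : k ⟶ l) (x : FreeBanachCategory 𝕜 X) (w : W.val l)
    (t : (F.obj k).val x) :
    colimitLeg W F k x (W.res f w) t = colimitLeg W F l x w (app (F.map f) x t) :=
  Subtype.ext (ContinuousLinearMap.ext fun n => n.2 k l f w t)

/-- The universal weighted cocone. -/
noncomputable def colimitCocone : WeightedCocone W F (colimitObj W F) where
  app k := homMkL (ζ := colimitObj W F) (colimitLeg W F k) zero_le_one (norm_colimitLeg_le W F k)
  naturality f w := app_ext (ζ := colimitObj W F) fun x t => colimitLeg_res W F f x w t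

variable {W F} in
-- Colimits of Banach spaces by duality: a functional on `G` turns the cocone `B` into a scalar
-- cocone with bound `M * ‖g‖`. Transposing this assignment gives the factorization with bound `M`.
theorem exists_colimitVal_lift {x : FreeBanachCategory 𝕜 X} {G : Type v} [NormedAddCommGroup G]
    [NormedSpace 𝕜 G] [CompleteSpace G] (B : ∀ k, W.val k →L[𝕜] (F.obj k).val x →L[𝕜] G) {M : ℝ}
    (h0 : 0 ≤ M) (hB : ∀ k, ‖B k‖ ≤ M)
    (nat : ∀ (k l : K) (f : k ⟶ l) (w : W.val l) (t : (F.obj k).val x),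
      B k (W.res f w) t = B l w (app (F.map f) x t)) :
    ∃ g : colimitVal W F x →L[𝕜] G, ‖g‖ ≤ M ∧
      ∀ k w t, g (colimitLeg W F k x w t) = B k w t := by
  have hβ : ∀ (g : G →L[𝕜] 𝕜) (k),
      ‖((ContinuousLinearMap.compL 𝕜 ((F.obj k).val x) G 𝕜) g).comp (B k)‖ ≤
        M * ‖g‖ := fun g k => by
    refine ContinuousLinearMap.opNorm_le_bound₂ _ (by positivity) fun w t => ?_
    refine (g.le_opNorm (B k w t)).trans ?_
    calc ‖g‖ * ‖B k w t‖ ≤ ‖g‖ * (M * ‖w‖ * ‖t‖) := by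
          gcongr
          exact ContinuousLinearMap.le_of_opNorm_le _
            (ContinuousLinearMap.le_of_opNorm_le _ (hB k) w) t
      _ = _ := by ring
  let β : (G →L[𝕜] 𝕜) →L[𝕜] scalarCocones W F x :=
    LinearMap.mkContinuous
      { toFun := fun g => ⟨⟨fun k =>
            ((ContinuousLinearMap.compL 𝕜 ((F.obj k).val x) G 𝕜) g).comp (B k),
            memℓp_infty ⟨M * ‖g‖, by rintro _ ⟨k, rfl⟩; exact hβ g k⟩⟩,
          fun k l f w t => congrArg g (nat k l f w t)⟩
        map_add' := fun g g' => Subtype.ext (lp.ext (funext fun k =>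
          ContinuousLinearMap.ext fun w => ContinuousLinearMap.ext fun t => rfl))
        map_smul' := fun r g => Subtype.ext (lp.ext (funext fun k =>
          ContinuousLinearMap.ext fun w => ContinuousLinearMap.ext fun t => rfl)) } M
      (fun g => lp.norm_le_of_forall_le (by positivity) (hβ g))
  obtain ⟨g, hg, hg'⟩ := closedSpan.exists_lift_dual (ev := coconeEval W F x)
    (fun s => B s.1 s.2.1 s.2.2) β (fun s g => rfl)
  exact ⟨g, hg.trans (LinearMap.mkContinuous_norm_le _ h0 _), fun k w t => hg' ⟨k, w, t⟩⟩

/-- Colimits are computed pointwise. The pointwise factorizations share the bound `M`, so they form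
a bounded family, and over a set such a family is automatically natural. -/
theorem isBanachTwoSpace : IsBanachTwoSpace 𝕜 (PShvSet 𝕜 X) := by
  intro K _ _ _ W F
  refine ⟨colimitObj W F, colimitCocone W F,
    fun k => norm_homMkL_le (ζ := colimitObj W F) _ zero_le_one (norm_colimitLeg_le W F k),
    fun d ψ M hM hψ => ?_⟩
  have hB : ∀ k x, ‖(appL (F.obj k) d x).comp (ψ.app k)‖ ≤ M := fun k x =>
    ContinuousLinearMap.opNorm_le_bound _ hM fun w =>
      (norm_app_le (ψ.app k w) x).trans (WeightedCocone.norm_app_apply_le hψ k w)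
  choose g hg hg' using fun x => exists_colimitVal_lift (W := W) (F := F) (x := x)
    (fun k => (appL (F.obj k) d x).comp (ψ.app k)) hM (fun k => hB k x) (fun k l f w t => by
      change app (ψ.app k (W.res f w)) x t = app (ψ.app l w) x (app (F.map f) x t)
      rw [ψ.naturality, comp_app])
  refine ⟨homMk (ξ := colimitObj W F) g M hg, norm_homMk_le (ξ := colimitObj W F) _ _ hM,
    fun k w => app_ext fun x t => hg' x k w t, fun g' h => hom_ext fun x => ?_⟩
  refine colimitVal_hom_ext (W := W) (F := F) fun s => ?_
  exact (congrArg (fun σ => app σ x s.2.2) (h s.1 s.2.1)).trans (hg' x s.1 s.2.1 s.2.2).symm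

end PShvSet

/-! ### Bilinear maps from linear maps on the projective tensor product -/

namespace Ban

variable {𝕜 : Type v} [RCLike 𝕜] {E F G : Type v} [NormedAddCommGroup E] [NormedSpace 𝕜 E]
  [NormedAddCommGroup F] [NormedSpace 𝕜 F] [NormedAddCommGroup G] [NormedSpace 𝕜 G]

theorem norm_apply_tmul_le (g : tensor (𝕜 := 𝕜) E F →L[𝕜] G) (e : E) (f : F) :
    ‖g (tmul e f)‖ ≤ ‖g‖ * ‖e‖ * ‖f‖ := by
  rw [mul_assoc]
  exact (g.le_opNorm _).trans (mul_le_mul_of_nonneg_left (norm_tmul_le e f) (norm_nonneg g))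

theorem tmul_add_left (e e' : E) (f : F) :
    tmul (𝕜 := 𝕜) (e + e') f = tmul (𝕜 := 𝕜) e f + tmul (𝕜 := 𝕜) e' f := by
  rw [map_add, add_apply]

theorem tmul_smul_left (r : 𝕜) (e : E) (f : F) :
    tmul (𝕜 := 𝕜) (r • e) f = r • tmul (𝕜 := 𝕜) e f := by
  rw [map_smul, smul_apply]

/-- The bilinear map which corresponds to a linear map on the tensor product. -/
noncomputable def curry (g : tensor (𝕜 := 𝕜) E F →L[𝕜] G) : E →L[𝕜] F →L[𝕜] G :=
  (ContinuousLinearMap.compL 𝕜 F (tensor (𝕜 := 𝕜) E F) G g).comp tmul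

theorem norm_curry_le (g : tensor (𝕜 := 𝕜) E F →L[𝕜] G) : ‖curry g‖ ≤ ‖g‖ :=
  ContinuousLinearMap.opNorm_le_bound₂ _ (norm_nonneg g) (norm_apply_tmul_le g)

end Ban

/-! ### The pointwise tensor product and its bicocontinuity -/

namespace PShvSet

open PShv Ban

variable {𝕜 : Type v} [RCLike 𝕜] {X Y : Type v}

/-- The pointwise projective tensor product of presheaves. -/
noncomputable def tensorObj (ξ : PShvSet 𝕜 X) (ζ : PShvSet 𝕜 Y) : PShvSet 𝕜 (X × Y) :=
  ofFamily fun p => tensor (𝕜 := 𝕜) (ξ.val ⟨p.1⟩) (ζ.val ⟨p.2⟩)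

theorem tensorObj_hom_ext {ξ : PShvSet 𝕜 X} {ζ : PShvSet 𝕜 Y} {χ : PShvSet 𝕜 (X × Y)}
    {σ τ : tensorObj ξ ζ ⟶ χ}
    (h : ∀ (x : X) (y : Y) (s : ξ.val ⟨x⟩) (t : ζ.val ⟨y⟩),
      app σ ⟨(x, y)⟩ (tmul (𝕜 := 𝕜) s t) = app τ ⟨(x, y)⟩ (tmul (𝕜 := 𝕜) s t)) : σ = τ :=
  hom_ext fun p => tensor_hom_ext fun s t => h p.as.1 p.as.2 s t

variable (𝕜 X Y) in
/-- The pointwise projective tensor product as a bifunctor. -/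
noncomputable def tensorBifunctor :
    ContractiveBifunctor 𝕜 (PShvSet 𝕜 X) (PShvSet 𝕜 Y) (PShvSet 𝕜 (X × Y)) where
  obj p := tensorObj p.1 p.2
  map {p q} f := homMk (ξ := tensorObj p.1 p.2) (ζ := tensorObj q.1 q.2)
    (fun z => tensorMap (app f.1 ⟨z.as.1⟩) (app f.2 ⟨z.as.2⟩)) (‖f.1‖ * ‖f.2‖)
    (fun z => (norm_tensorMap_le _ _).trans
      (mul_le_mul (norm_app_le _ _) (norm_app_le _ _) (norm_nonneg _) (norm_nonneg _)))
  map_id p := tensorObj_hom_ext fun x y s t => tensorMap_tmul _ _ s t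
  map_comp f g := tensorObj_hom_ext fun x y s t =>
    (tensorMap_tmul _ _ s t).trans (((congrArg _ (tensorMap_tmul _ _ s t)).trans
      (tensorMap_tmul _ _ _ _)).symm)
  map_add_left f f' g := tensorObj_hom_ext fun x y s t => by
    refine (tensorMap_tmul _ _ s t).trans (Eq.trans ?_ (congrArg₂ (· + ·)
      (tensorMap_tmul (app f ⟨x⟩) (app g ⟨y⟩) s t) (tensorMap_tmul (app f' ⟨x⟩) _ s t)).symm)
    exact tmul_add_left _ _ _
  map_add_right f g g' := tensorObj_hom_ext fun x y s t => by
    refine (tensorMap_tmul _ _ s t).trans (Eq.trans ?_ (congrArg₂ (· + ·)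
      (tensorMap_tmul (app f ⟨x⟩) (app g ⟨y⟩) s t) (tensorMap_tmul _ (app g' ⟨y⟩) s t)).symm)
    exact _root_.map_add (tmul (app f ⟨x⟩ s)) (app g ⟨y⟩ t) (app g' ⟨y⟩ t)
  map_smul_left r f g := tensorObj_hom_ext fun x y s t => by
    refine (tensorMap_tmul _ _ s t).trans (Eq.trans ?_ (congrArg (r • ·)
      (tensorMap_tmul (app f ⟨x⟩) (app g ⟨y⟩) s t)).symm)
    exact tmul_smul_left _ _ _
  map_smul_right r f g := tensorObj_hom_ext fun x y s t => by
    refine (tensorMap_tmul _ _ s t).trans (Eq.trans ?_ (congrArg (r • ·)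
      (tensorMap_tmul (app f ⟨x⟩) (app g ⟨y⟩) s t)).symm)
    exact _root_.map_smul (tmul (app f ⟨x⟩ s)) r (app g ⟨y⟩ t)
  norm_map_le f g := norm_homMk_le (ξ := tensorObj _ _) (ζ := tensorObj _ _) _ _
    (mul_nonneg (norm_nonneg f) (norm_nonneg g))

theorem tensorBifunctor_map_app {ξ ξ' : PShvSet 𝕜 X} {ζ ζ' : PShvSet 𝕜 Y} (f : ξ ⟶ ξ')
    (g : ζ ⟶ ζ') (x : X) (y : Y) (s : ξ.val ⟨x⟩) (t : ζ.val ⟨y⟩) :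
    app ((tensorBifunctor 𝕜 X Y).map (Prod.mkHom f g)) ⟨(x, y)⟩ (tmul (𝕜 := 𝕜) s t) =
      tmul (𝕜 := 𝕜) (app f ⟨x⟩ s) (app g ⟨y⟩ t) :=
  tensorMap_tmul _ _ s t

/-- Restriction of a presheaf to a row. -/
noncomputable def row (χ : PShvSet 𝕜 (X × Y)) (y : Y) : PShvSet 𝕜 X :=
  ofFamily fun x => χ.toFunctor.obj (op ⟨(x, y)⟩)

/-- Restriction of a presheaf to a column. -/
noncomputable def column (χ : PShvSet 𝕜 (X × Y)) (x : X) : PShvSet 𝕜 Y :=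
  ofFamily fun y => χ.toFunctor.obj (op ⟨(x, y)⟩)

/-- The right adjoint of `tensorObj ξ`. -/
noncomputable def rowHom (ξ : PShvSet 𝕜 X) (χ : PShvSet 𝕜 (X × Y)) : PShvSet 𝕜 Y :=
  ofFamily fun y => ⟨ξ ⟶ row χ y⟩

/-- The right adjoint of `tensorObj · ζ`. -/
noncomputable def columnHom (ζ : PShvSet 𝕜 Y) (χ : PShvSet 𝕜 (X × Y)) : PShvSet 𝕜 X :=
  ofFamily fun x => ⟨ζ ⟶ column χ x⟩

/-! ### Currying in each variable -/

section Adjunction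

variable (ξ : PShvSet 𝕜 X) (ζ : PShvSet 𝕜 Y) (χ : PShvSet 𝕜 (X × Y))

/-- The bilinear map at a point which corresponds to a morphism out of the tensor product. -/
noncomputable def bilinApp (g : tensorObj ξ ζ ⟶ χ) (x : X) (y : Y) :
    ξ.val ⟨x⟩ →L[𝕜] ζ.val ⟨y⟩ →L[𝕜] χ.val ⟨(x, y)⟩ :=
  curry (app g ⟨(x, y)⟩)

theorem norm_bilinApp_le (g : tensorObj ξ ζ ⟶ χ) (x : X) (y : Y) :
    ‖bilinApp ξ ζ χ g x y‖ ≤ ‖g‖ :=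
  (norm_curry_le _).trans (norm_app_le g _)

theorem norm_flip_bilinApp_le (g : tensorObj ξ ζ ⟶ χ) (x : X) (y : Y) :
    ‖(bilinApp ξ ζ χ g x y).flip‖ ≤ ‖g‖ :=
  (ContinuousLinearMap.opNorm_flip _).trans_le (norm_bilinApp_le ξ ζ χ g x y)

/-- Currying in the second variable at a point. -/
noncomputable def rowCurryApp (g : tensorObj ξ ζ ⟶ χ) (y : Y) :
    ζ.val ⟨y⟩ →L[𝕜] (ξ ⟶ row χ y) :=
  homMkL (ξ := ξ) (ζ := row χ y) (fun x => (bilinApp ξ ζ χ g x.as y).flip) (norm_nonneg g)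
    (fun x => norm_flip_bilinApp_le ξ ζ χ g x.as y)

theorem norm_rowCurryApp_le (g : tensorObj ξ ζ ⟶ χ) (y : Y) : ‖rowCurryApp ξ ζ χ g y‖ ≤ ‖g‖ :=
  norm_homMkL_le (ξ := ξ) (ζ := row χ y) (fun x => (bilinApp ξ ζ χ g x.as y).flip)
    (norm_nonneg g) (fun x => norm_flip_bilinApp_le ξ ζ χ g x.as y)

/-- Currying in the first variable at a point. -/
noncomputable def columnCurryApp (g : tensorObj ξ ζ ⟶ χ) (x : X) :
    ξ.val ⟨x⟩ →L[𝕜] (ζ ⟶ column χ x) :=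
  homMkL (ξ := ζ) (ζ := column χ x) (fun y => bilinApp ξ ζ χ g x y.as) (norm_nonneg g)
    (fun y => norm_bilinApp_le ξ ζ χ g x y.as)

theorem norm_columnCurryApp_le (g : tensorObj ξ ζ ⟶ χ) (x : X) :
    ‖columnCurryApp ξ ζ χ g x‖ ≤ ‖g‖ :=
  norm_homMkL_le (ξ := ζ) (ζ := column χ x) (fun y => bilinApp ξ ζ χ g x y.as)
    (norm_nonneg g) (fun y => norm_bilinApp_le ξ ζ χ g x y.as)

/-- Currying in the second variable. -/
noncomputable def rowCurry : (tensorObj ξ ζ ⟶ χ) →ₗ[𝕜] (ζ ⟶ rowHom ξ χ) where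
  toFun g := homMk (ζ := rowHom ξ χ) (fun y => rowCurryApp ξ ζ χ g y.as) ‖g‖
    (fun y => norm_rowCurryApp_le ξ ζ χ g y.as)
  map_add' _ _ := app_ext (ζ := rowHom ξ χ) fun y _ =>
    app_ext (ζ := row χ y.as) fun _ _ => rfl
  map_smul' _ _ := app_ext (ζ := rowHom ξ χ) fun y _ =>
    app_ext (ζ := row χ y.as) fun _ _ => rfl

/-- Currying in the first variable. -/
noncomputable def columnCurry : (tensorObj ξ ζ ⟶ χ) →ₗ[𝕜] (ξ ⟶ columnHom ζ χ) where
  toFun g := homMk (ζ := columnHom ζ χ) (fun x => columnCurryApp ξ ζ χ g x.as) ‖g‖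
    (fun x => norm_columnCurryApp_le ξ ζ χ g x.as)
  map_add' _ _ := app_ext (ζ := columnHom ζ χ) fun x _ =>
    app_ext (ζ := column χ x.as) fun _ _ => rfl
  map_smul' _ _ := app_ext (ζ := columnHom ζ χ) fun x _ =>
    app_ext (ζ := column χ x.as) fun _ _ => rfl

/-- Uncurrying does not increase the norm: evaluating `f` pointwise gives bilinear maps bounded by
`‖f‖`, and their lifts to the projective tensor products keep this bound. -/
theorem exists_rowCurry_eq (f : ζ ⟶ rowHom ξ χ) :
    ∃ g : tensorObj ξ ζ ⟶ χ, ‖g‖ ≤ ‖f‖ ∧ rowCurry ξ ζ χ g = f := by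
  let f' : ∀ y : Y, ζ.val ⟨y⟩ →L[𝕜] (ξ ⟶ row χ y) := fun y => app f ⟨y⟩
  have hf' : ∀ y, ‖f' y‖ ≤ ‖f‖ := fun y => norm_app_le f ⟨y⟩
  -- The components of `f` take the variable of `ζ` first, hence the `flip`.
  let B : ∀ (x : X) (y : Y), ξ.val ⟨x⟩ →L[𝕜] ζ.val ⟨y⟩ →L[𝕜] χ.val ⟨(x, y)⟩ := fun x y =>
    ((appL ξ (row χ y) ⟨x⟩).comp (f' y)).flip
  have hB : ∀ x y, ‖B x y‖ ≤ ‖f‖ := fun x y =>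
    ContinuousLinearMap.opNorm_le_bound₂ _ (norm_nonneg f) fun s t => by
      refine (norm_app_apply_le (f' y t) ⟨x⟩ s).trans ?_
      rw [mul_right_comm]
      exact mul_le_mul_of_nonneg_right (ContinuousLinearMap.le_of_opNorm_le _ (hf' y) t)
        (norm_nonneg s)
  have hL : ∀ z : FreeBanachCategory 𝕜 (X × Y), ‖tensorLift (B z.as.1 z.as.2)‖ ≤ ‖f‖ := fun z =>
    (norm_tensorLift_le _).trans (hB z.as.1 z.as.2)
  refine ⟨homMk (ξ := tensorObj ξ ζ) (fun z => tensorLift (B z.as.1 z.as.2)) ‖f‖ hL,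
    norm_homMk_le (ξ := tensorObj ξ ζ) _ hL (norm_nonneg f),
    app_ext (ζ := rowHom ξ χ) fun y t => app_ext (ζ := row χ y.as) fun x s => ?_⟩
  exact tensorLift_tmul (B x.as y.as) s t

theorem exists_columnCurry_eq (f : ξ ⟶ columnHom ζ χ) :
    ∃ g : tensorObj ξ ζ ⟶ χ, ‖g‖ ≤ ‖f‖ ∧ columnCurry ξ ζ χ g = f := by
  let f' : ∀ x : X, ξ.val ⟨x⟩ →L[𝕜] (ζ ⟶ column χ x) := fun x => app f ⟨x⟩
  have hf' : ∀ x, ‖f' x‖ ≤ ‖f‖ := fun x => norm_app_le f ⟨x⟩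
  let B : ∀ (x : X) (y : Y), ξ.val ⟨x⟩ →L[𝕜] ζ.val ⟨y⟩ →L[𝕜] χ.val ⟨(x, y)⟩ := fun x y =>
    (appL ζ (column χ x) ⟨y⟩).comp (f' x)
  have hB : ∀ x y, ‖B x y‖ ≤ ‖f‖ := fun x y =>
    ContinuousLinearMap.opNorm_le_bound₂ _ (norm_nonneg f) fun s t =>
      (norm_app_apply_le (f' x s) ⟨y⟩ t).trans
        (mul_le_mul_of_nonneg_right (ContinuousLinearMap.le_of_opNorm_le _ (hf' x) s)
          (norm_nonneg t))
  have hL : ∀ z : FreeBanachCategory 𝕜 (X × Y), ‖tensorLift (B z.as.1 z.as.2)‖ ≤ ‖f‖ := fun z =>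
    (norm_tensorLift_le _).trans (hB z.as.1 z.as.2)
  refine ⟨homMk (ξ := tensorObj ξ ζ) (fun z => tensorLift (B z.as.1 z.as.2)) ‖f‖ hL,
    norm_homMk_le (ξ := tensorObj ξ ζ) _ hL (norm_nonneg f),
    app_ext (ζ := columnHom ζ χ) fun x s => app_ext (ζ := column χ x.as) fun y t => ?_⟩
  exact tensorLift_tmul (B x.as y.as) s t

end Adjunction

/-- Currying identifies morphisms `ξ ⊗ ζ ⟶ χ` isometrically with morphisms `ζ ⟶ rowHom ξ χ`,
naturally in `ζ`; a left adjoint in this sense preserves weighted colimits. -/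
theorem tensorBifunctor_left_isCocontinuous (ξ : PShvSet 𝕜 X) :
    ((tensorBifunctor 𝕜 X Y).left ξ).IsCocontinuous := by
  refine ContractiveFunctor.isCocontinuous_of_representable _ fun χ =>
    ⟨rowHom ξ χ, fun ζ => rowCurry ξ ζ χ, fun ζ g => ?_, fun ζ g g' h => ?_,
      fun ζ f => exists_rowCurry_eq ξ ζ χ f, fun ζ ζ' f g => ?_⟩
  · exact norm_homMk_le (ζ := rowHom ξ χ) (fun y => rowCurryApp ξ ζ χ g y.as)
      (fun y => norm_rowCurryApp_le ξ ζ χ g y.as) (norm_nonneg g)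
  · refine tensorObj_hom_ext fun x y s t => ?_
    have h1 : rowCurryApp ξ ζ χ g y t = rowCurryApp ξ ζ χ g' y t :=
      congrArg (fun σ : ζ ⟶ rowHom ξ χ => app σ ⟨y⟩ t) h
    exact congrArg (fun σ : ξ ⟶ row χ y => app σ ⟨x⟩ s) h1
  · refine app_ext (ζ := rowHom ξ χ) fun y t => app_ext (ζ := row χ y.as) fun x s => ?_
    exact congrArg (app g ⟨(x.as, y.as)⟩)
      (tensorBifunctor_map_app (𝟙 ξ) f x.as y.as s t)

theorem tensorBifunctor_right_isCocontinuous (ζ : PShvSet 𝕜 Y) :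
    ((tensorBifunctor 𝕜 X Y).right ζ).IsCocontinuous := by
  refine ContractiveFunctor.isCocontinuous_of_representable _ fun χ =>
    ⟨columnHom ζ χ, fun ξ => columnCurry ξ ζ χ, fun ξ g => ?_, fun ξ g g' h => ?_,
      fun ξ f => exists_columnCurry_eq ξ ζ χ f, fun ξ ξ' f g => ?_⟩
  · exact norm_homMk_le (ζ := columnHom ζ χ) (fun x => columnCurryApp ξ ζ χ g x.as)
      (fun x => norm_columnCurryApp_le ξ ζ χ g x.as) (norm_nonneg g)
  · refine tensorObj_hom_ext fun x y s t => ?_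
    have h1 : columnCurryApp ξ ζ χ g x s = columnCurryApp ξ ζ χ g' x s :=
      congrArg (fun σ : ξ ⟶ columnHom ζ χ => app σ ⟨x⟩ s) h
    exact congrArg (fun σ : ζ ⟶ column χ x => app σ ⟨y⟩ t) h1
  · refine app_ext (ζ := columnHom ζ χ) fun x s => app_ext (ζ := column χ x.as) fun y t => ?_
    exact congrArg (app g ⟨(x.as, y.as)⟩)
      (tensorBifunctor_map_app f (𝟙 ζ) x.as y.as s t)

theorem tensorBifunctor_isBicocontinuous : (tensorBifunctor 𝕜 X Y).IsBicocontinuous :=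
  ⟨tensorBifunctor_left_isCocontinuous, tensorBifunctor_right_isCocontinuous⟩

end PShvSet

/-! ### Tensor products of representable presheaves -/

namespace FreeBanachCategory

variable {𝕜 : Type v} [RCLike 𝕜] {X Y : Type v} {a a' : FreeBanachCategory 𝕜 X}
  {b b' : FreeBanachCategory 𝕜 Y}

/-- The product of morphisms. -/
def pair (r : a ⟶ a') (s : b ⟶ b') :
    (⟨(a.as, b.as)⟩ : FreeBanachCategory 𝕜 (X × Y)) ⟶ ⟨(a'.as, b'.as)⟩ :=
  ⟨r.1 * s.1, fun h => by
    by_cases ha : a.as = a'.as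
    · rw [s.2 fun hb => h (Prod.ext ha hb), mul_zero]
    · rw [r.2 ha, zero_mul]⟩

/-- The product of morphisms as a bounded bilinear map. -/
noncomputable def pairL (a a' : FreeBanachCategory 𝕜 X) (b b' : FreeBanachCategory 𝕜 Y) :
    (a ⟶ a') →L[𝕜] (b ⟶ b') →L[𝕜]
      ((⟨(a.as, b.as)⟩ : FreeBanachCategory 𝕜 (X × Y)) ⟶ ⟨(a'.as, b'.as)⟩) :=
  LinearMap.mkContinuous₂ (LinearMap.mk₂ 𝕜 pair
    (fun r r' s => Subtype.ext (add_mul r.1 r'.1 s.1))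
    (fun c r s => Subtype.ext (mul_assoc c r.1 s.1))
    (fun r s s' => Subtype.ext (mul_add r.1 s.1 s'.1))
    (fun c r s => Subtype.ext (mul_left_comm r.1 c s.1))) 1
    (fun r s => ((norm_mul r.1 s.1).trans (by rw [one_mul]; rfl)).le)

theorem norm_pairL_le (a a' : FreeBanachCategory 𝕜 X) (b b' : FreeBanachCategory 𝕜 Y) :
    ‖pairL a a' b b'‖ ≤ 1 :=
  LinearMap.mkContinuous₂_norm_le _ zero_le_one _

theorem pair_id (a : FreeBanachCategory 𝕜 X) (b : FreeBanachCategory 𝕜 Y) :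
    pair (𝟙 a) (𝟙 b) = 𝟙 _ :=
  Subtype.ext (mul_one 1)

end FreeBanachCategory

namespace PShvSet

open PShv Ban FreeBanachCategory

variable {𝕜 : Type v} [RCLike 𝕜] {X Y : Type v}

/-- `tensorObj` is built from its values alone, so its restriction maps are not defined through
those of the factors. The two agree because every morphism over a set is zero or a multiple of an
identity, and scalars pass through the tensor product. -/
theorem res_pair_tmul (ξ : PShvSet 𝕜 X) (ζ : PShvSet 𝕜 Y) {a a' : FreeBanachCategory 𝕜 X}
    {b b' : FreeBanachCategory 𝕜 Y} (r : a ⟶ a') (s : b ⟶ b') (u : ξ.val a') (w : ζ.val b') :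
    (tensorObj ξ ζ).res (pair r s) (tmul (𝕜 := 𝕜) u w) =
      tmul (𝕜 := 𝕜) (ξ.res r u) (ζ.res s w) := by
  have res_zero : ∀ {X : Type v} (χ : PShvSet 𝕜 X) {c d : FreeBanachCategory 𝕜 X} (t : χ.val d),
      χ.res (0 : c ⟶ d) t = 0 := fun χ c d t => by
    have := res_smul (ξ := χ) (0 : 𝕜) (0 : c ⟶ d) t
    rwa [zero_smul, zero_smul] at this
  revert u w
  refine hom_induction (P := fun {a a'} r => ∀ (u : ξ.val a') (w : ζ.val b'),
    (tensorObj ξ ζ).res (pair r s) (tmul (𝕜 := 𝕜) u w) =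
      tmul (𝕜 := 𝕜) (ξ.res r u) (ζ.res s w)) ?_ ?_ r
  · intro a a' u w
    have h : pair (0 : a ⟶ a') s = 0 := Subtype.ext (zero_mul s.1)
    rw [h, res_zero ξ, _root_.map_zero]
    exact res_zero (tensorObj ξ ζ) _
  · intro a c
    refine hom_induction (P := fun {b b'} s => ∀ (u : ξ.val a) (w : ζ.val b'),
      (tensorObj ξ ζ).res (pair (c • 𝟙 a) s) (tmul (𝕜 := 𝕜) u w) =
        tmul (𝕜 := 𝕜) (ξ.res (c • 𝟙 a) u) (ζ.res s w)) ?_ ?_ s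
    · intro b b' u w
      have h : pair (c • 𝟙 a) (0 : b ⟶ b') = 0 := Subtype.ext (mul_zero _)
      rw [h, res_zero ζ, _root_.map_zero]
      exact res_zero (tensorObj ξ ζ) _
    · intro b d u w
      have h : pair (c • 𝟙 a) (d • 𝟙 b) = (c * d) • 𝟙 _ :=
        Subtype.ext (mul_mul_mul_comm c 1 d 1 |>.trans (by rw [mul_one]; rfl))
      rw [h, res_smul (ξ := ξ) c, res_smul (ξ := ζ) d, res_id, res_id, tmul_smul_left,
        _root_.map_smul, smul_smul]
      exact (res_smul (ξ := tensorObj ξ ζ) (c * d) (𝟙 _) _).trans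
        (congrArg _ (res_id (ξ := tensorObj ξ ζ) _ _))

/-- The tensor product of representable presheaves is representable. -/
theorem exists_tensor_yoneda_iso (a : FreeBanachCategory 𝕜 X) (b : FreeBanachCategory 𝕜 Y) :
    ∃ e : tensorObj ((yoneda 𝕜 (FreeBanachCategory 𝕜 X)).obj a)
        ((yoneda 𝕜 (FreeBanachCategory 𝕜 Y)).obj b) ≅
      (yoneda 𝕜 (FreeBanachCategory 𝕜 (X × Y))).obj ⟨(a.as, b.as)⟩,
      ‖e.hom‖ ≤ 1 ∧ ‖e.inv‖ ≤ 1 := by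
  let T := tensorObj ((yoneda 𝕜 (FreeBanachCategory 𝕜 X)).obj a)
    ((yoneda 𝕜 (FreeBanachCategory 𝕜 Y)).obj b)
  let R := (yoneda 𝕜 (FreeBanachCategory 𝕜 (X × Y))).obj ⟨(a.as, b.as)⟩
  -- Forward map: at each point it multiplies the two scalars.
  let m : ∀ z : FreeBanachCategory 𝕜 (X × Y), T.val z →L[𝕜] R.val z := fun z =>
    tensorLift (pairL ⟨z.as.1⟩ a ⟨z.as.2⟩ b)
  have hm : ∀ z, ‖m z‖ ≤ 1 := fun z => (norm_tensorLift_le _).trans (norm_pairL_le _ _ _ _)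
  -- By Yoneda the backward map is an element of `T` at `(a, b)`; the tensor of the two identities
  -- is taken.
  let one : T.val ⟨(a.as, b.as)⟩ :=
    tmul (𝕜 := 𝕜) (show a ⟶ a from 𝟙 a) (show b ⟶ b from 𝟙 b)
  have hone : ‖one‖ ≤ 1 := (norm_tmul_le _ _).trans
    (mul_le_one₀ (NormedCategory.norm_id_le a) (norm_nonneg _) (NormedCategory.norm_id_le b))
  have hm1 : m ⟨(a.as, b.as)⟩ one = 𝟙 (⟨(a.as, b.as)⟩ : FreeBanachCategory 𝕜 (X × Y)) :=
    (tensorLift_tmul _ _ _).trans (pair_id a b)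
  refine ⟨⟨homMk m 1 hm, ofElement T one, ?_, ?_⟩, norm_homMk_le m hm zero_le_one,
    (norm_ofElement_le _ _).trans hone⟩
  -- On `r ⊗ s` the composite restricts the tensor of identities along `pair r s`, which returns `r
  -- ⊗ s` by `res_pair_tmul`.
  · refine tensorObj_hom_ext fun x y r s => ?_
    have h1 : m ⟨(x, y)⟩ (tmul (𝕜 := 𝕜) r s) = pair (a := ⟨x⟩) (b := ⟨y⟩) r s :=
      tensorLift_tmul _ _ _
    refine (congrArg (app (ofElement T one) ⟨(x, y)⟩) h1).trans ?_
    refine (res_pair_tmul _ _ _ _ _ _).trans ?_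
    exact congrArg₂ (fun p q => tmul (𝕜 := 𝕜) p q)
      (Category.comp_id (show (⟨x⟩ : FreeBanachCategory 𝕜 X) ⟶ a from r))
      (Category.comp_id (show (⟨y⟩ : FreeBanachCategory 𝕜 Y) ⟶ b from s))
  -- The composite is an endomorphism of a representable, so it suffices that its classifying
  -- element is the identity.
  · rw [ofElement_comp]
    refine (congrArg (ofElement R) hm1).trans ?_
    exact (ofElement_yoneda _).trans ((yoneda 𝕜 _).map_id _)

end PShvSet

/-! ### Isometric isomorphisms -/

section IsometricallyIsomorphic

variable {A : Type u₁} [Category.{v} A] {B : Type u₂} [Category.{v} B] [NormedCategory B]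

theorem NatTransBoundedBy.comp {F G H : A ⥤ B} {σ : F ⟶ G} {τ : G ⟶ H} {M N : ℝ}
    (hσ : NatTransBoundedBy σ M) (hτ : NatTransBoundedBy τ N) :
    NatTransBoundedBy (σ ≫ τ) (M * N) :=
  fun a => NormedCategory.norm_comp_le_of_le (hσ a) (hτ a)

theorem NatTransBoundedBy.id (F : A ⥤ B) : NatTransBoundedBy (𝟙 F) 1 :=
  fun _ => NormedCategory.norm_id_le _

theorem IsometricallyIsomorphic.symm {F G : A ⥤ B} (h : IsometricallyIsomorphic F G) :
    IsometricallyIsomorphic G F :=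
  let ⟨e, h1, h2⟩ := h
  ⟨e.symm, h2, h1⟩

theorem IsometricallyIsomorphic.trans {F G H : A ⥤ B} (h : IsometricallyIsomorphic F G)
    (h' : IsometricallyIsomorphic G H) : IsometricallyIsomorphic F H :=
  let ⟨e, h1, h2⟩ := h
  let ⟨e', h1', h2'⟩ := h'
  ⟨e ≪≫ e', fun a => (h1.comp h1' a).trans_eq (one_mul 1),
    fun a => (h2'.comp h2 a).trans_eq (one_mul 1)⟩

theorem IsometricallyIsomorphic.comp_right {𝕜 : Type*} [RCLike 𝕜] [BanachCategory 𝕜 B]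
    {C : Type u₃} [Category.{v} C] [NormedCategory C] [BanachCategory 𝕜 C]
    {F G : A ⥤ B} (h : IsometricallyIsomorphic F G) (T : ContractiveFunctor 𝕜 B C) :
    IsometricallyIsomorphic (F ⋙ T.toFunctor) (G ⋙ T.toFunctor) :=
  let ⟨e, h1, h2⟩ := h
  ⟨Functor.isoWhiskerRight e T.toFunctor, fun a => (T.norm_map_le _).trans (h1 a),
    fun a => (T.norm_map_le _).trans (h2 a)⟩

end IsometricallyIsomorphic

/-! ### Uniqueness of bitensor products -/

section Uniqueness

variable {𝕜 : Type v} [RCLike 𝕜]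
  {A : Type u₁} [Category.{v} A] [NormedCategory A] [BanachCategory 𝕜 A]
  {B : Type u₂} [Category.{v} B] [NormedCategory B] [BanachCategory 𝕜 B]
  {Z : Type u₃} [Category.{v} Z] [NormedCategory Z] [BanachCategory 𝕜 Z]

/-- Both directions of the isomorphism extend from `j` to contractive transformations, and
uniqueness of extensions makes them mutually inverse. -/
theorem IsBitensorProduct.isometricallyIsomorphic {j : ContractiveBifunctor 𝕜 A B Z}
    (hj : IsBitensorProduct.{v, u₁, u₂, u₃, w} j) {C : Type w} [Category.{v} C] [NormedCategory C]
    [BanachCategory 𝕜 C] (hC : IsBanachTwoSpace 𝕜 C) {S T : ContractiveFunctor 𝕜 Z C}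
    (hS : S.IsCocontinuous) (hT : T.IsCocontinuous)
    (h : IsometricallyIsomorphic (j.toFunctor ⋙ S.toFunctor) (j.toFunctor ⋙ T.toFunctor)) :
    IsometricallyIsomorphic S.toFunctor T.toFunctor := by
  obtain ⟨e, he, he'⟩ := h
  -- The bound `1 * 1` is the one that `NatTransBoundedBy.comp` produces for a composite of
  -- contractive transformations.
  have key : ∀ {S : ContractiveFunctor 𝕜 Z C}, S.IsCocontinuous → ∀ τ : S.toFunctor ⟶ S.toFunctor,
      NatTransBoundedBy τ (1 * 1) → (∀ p, τ.app (j.obj p) = 𝟙 _) → τ = 𝟙 _ := by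
    intro S hS τ hτ hτ'
    rw [one_mul] at hτ
    exact (hj.extension C hC S S hS hS (𝟙 _) 1 zero_le_one (.id _)).unique ⟨hτ, hτ'⟩
      ⟨.id _, fun _ => rfl⟩
  obtain ⟨τ, ⟨hτ, hτe⟩, -⟩ := hj.extension C hC S T hS hT e.hom 1 zero_le_one he
  obtain ⟨τ', ⟨hτ', hτe'⟩, -⟩ := hj.extension C hC T S hT hS e.inv 1 zero_le_one he'
  refine ⟨⟨τ, τ', key hS _ (hτ.comp hτ') fun p => ?_, key hT _ (hτ'.comp hτ) fun p => ?_⟩, hτ, hτ'⟩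
  · rw [NatTrans.comp_app, hτe, hτe']
    exact e.hom_inv_id_app p
  · rw [NatTrans.comp_app, hτe, hτe']
    exact e.inv_hom_id_app p

/-- Each bifunctor factors through the other. The two composites restrict, up to isometric
isomorphism, to `j` and `i`, as the identities do, so they are isometrically isomorphic to the
identities. The universe `w` is shared because each space serves as a test object for the other. -/
theorem IsBitensorProduct.exists_equivalence {Z Z' : Type w}
    [Category.{v} Z] [NormedCategory Z] [BanachCategory 𝕜 Z]
    [Category.{v} Z'] [NormedCategory Z'] [BanachCategory 𝕜 Z']
    {j : ContractiveBifunctor 𝕜 A B Z} {i : ContractiveBifunctor 𝕜 A B Z'}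
    (hj : IsBitensorProduct.{v, u₁, u₂, w, w} j) (hi : IsBitensorProduct.{v, u₁, u₂, w, w} i) :
    ∃ E : ContractiveFunctor 𝕜 Z Z', E.IsBanachEquivalence ∧
      IsometricallyIsomorphic (j.toFunctor ⋙ E.toFunctor) i.toFunctor := by
  obtain ⟨E, hE, hEi⟩ := hj.factorization Z' hi.isBanachTwoSpace i hi.isBicocontinuous
  obtain ⟨S, hS, hSj⟩ := hi.factorization Z hj.isBanachTwoSpace j hj.isBicocontinuous
  refine ⟨E, ⟨hE, S, hS, ?_, ?_⟩, hEi⟩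
  · exact hj.isometricallyIsomorphic hj.isBanachTwoSpace (S := E.comp S)
      (T := ContractiveFunctor.id 𝕜 Z) (hE.comp hS) ContractiveFunctor.isCocontinuous_id
      ((hEi.comp_right S).trans hSj)
  · exact hi.isometricallyIsomorphic hi.isBanachTwoSpace (S := S.comp E)
      (T := ContractiveFunctor.id 𝕜 Z') (hS.comp hE) ContractiveFunctor.isCocontinuous_id
      ((hSj.comp_right E).trans hEi)

end Uniqueness

/-! ### Bifunctors on presheaves on sets -/

namespace ContractiveBifunctor

section Comp

variable {𝕜 : Type v} [RCLike 𝕜]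
  {A : Type u₁} [Category.{v} A] [NormedCategory A] [BanachCategory 𝕜 A]
  {B : Type u₂} [Category.{v} B] [NormedCategory B] [BanachCategory 𝕜 B]
  {C : Type u₃} [Category.{v} C] [NormedCategory C] [BanachCategory 𝕜 C]
  {D : Type w} [Category.{v} D] [NormedCategory D] [BanachCategory 𝕜 D]

/-- Composition of a contractive bifunctor with a contractive functor. -/
def comp (φ : ContractiveBifunctor 𝕜 A B C) (T : ContractiveFunctor 𝕜 C D) :
    ContractiveBifunctor 𝕜 A B D where
  toFunctor := φ.toFunctor ⋙ T.toFunctor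
  map_add_left f f' g := (congrArg _ (φ.map_add_left f f' g)).trans (T.map_add _ _)
  map_add_right f g g' := (congrArg _ (φ.map_add_right f g g')).trans (T.map_add _ _)
  map_smul_left r f g := (congrArg _ (φ.map_smul_left r f g)).trans (T.map_smul _ _)
  map_smul_right r f g := (congrArg _ (φ.map_smul_right r f g)).trans (T.map_smul _ _)
  norm_map_le f g := (T.norm_map_le _).trans (φ.norm_map_le f g)

theorem IsBicocontinuous.comp {φ : ContractiveBifunctor 𝕜 A B C} (hφ : φ.IsBicocontinuous)
    {T : ContractiveFunctor 𝕜 C D} (hT : T.IsCocontinuous) : (φ.comp T).IsBicocontinuous :=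
  ⟨fun a => (hφ.1 a).comp hT, fun b => (hφ.2 b).comp hT⟩

/-- The transformation `φ(a, -) ⟶ φ'(a, -)`. -/
def leftTrans {φ φ' : ContractiveBifunctor 𝕜 A B C} (τ : φ.toFunctor ⟶ φ'.toFunctor) (a : A) :
    (φ.left a).toFunctor ⟶ (φ'.left a).toFunctor where
  app b := τ.app (a, b)
  naturality _ _ g := τ.naturality (Prod.mkHom (𝟙 a) g)

/-- The transformation `φ(-, b) ⟶ φ'(-, b)`. -/
def rightTrans {φ φ' : ContractiveBifunctor 𝕜 A B C} (τ : φ.toFunctor ⟶ φ'.toFunctor) (b : B) :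
    (φ.right b).toFunctor ⟶ (φ'.right b).toFunctor where
  app a := τ.app (a, b)
  naturality _ _ f := τ.naturality (Prod.mkHom f (𝟙 b))

/-- The transformation `φ(-, b) ⟶ φ(-, b')` induced by a morphism. -/
def rightMap (φ : ContractiveBifunctor 𝕜 A B C) {b b' : B} (g : b ⟶ b') :
    (φ.right b).toFunctor ⟶ (φ.right b').toFunctor where
  app a := φ.map (Prod.mkHom (𝟙 a) g)
  naturality a a' f := by
    change φ.map _ ≫ φ.map _ = φ.map _ ≫ φ.map _
    rw [← φ.map_comp, ← φ.map_comp]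
    simp

end Comp

open PShv FreeBanachCategory

variable {𝕜 : Type v} [RCLike 𝕜] {X Y : Type v}
  {C : Type u} [Category.{v} C] [NormedCategory C] [BanachCategory 𝕜 C]
  {φ φ' : ContractiveBifunctor 𝕜 (PShvSet 𝕜 X) (PShvSet 𝕜 Y) C}

/-- Density is used one variable at a time: with a representable in the first variable, the second
is freed; then, with an arbitrary second variable, the first is freed. -/
theorem natTrans_ext (hφ : φ.IsBicocontinuous) {τ τ' : φ.toFunctor ⟶ φ'.toFunctor}
    (h : ∀ a b, τ.app ((yoneda 𝕜 _).obj a, (yoneda 𝕜 _).obj b) =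
      τ'.app ((yoneda 𝕜 _).obj a, (yoneda 𝕜 _).obj b)) : τ = τ' := by
  have h1 : ∀ a, leftTrans τ ((yoneda 𝕜 _).obj a) = leftTrans τ' ((yoneda 𝕜 _).obj a) :=
    fun a => PShv.natTrans_ext (hφ.1 _) (h a)
  have h2 : ∀ ζ, rightTrans τ ζ = rightTrans τ' ζ := fun ζ =>
    PShv.natTrans_ext (hφ.2 ζ) fun a => congrArg (fun σ => σ.app ζ) (h1 a)
  ext ⟨ξ, ζ⟩
  exact congrArg (fun σ => σ.app ξ) (h2 ζ)

/-- A bounded family of morphisms between the values of bifunctors at representable presheaves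
extends to all presheaves, provided that the first bifunctor is bicocontinuous. -/
theorem exists_natTrans_extension (hφ : φ.IsBicocontinuous)
    (σ : ∀ a b, φ.obj ((yoneda 𝕜 _).obj a, (yoneda 𝕜 _).obj b) ⟶
      φ'.obj ((yoneda 𝕜 _).obj a, (yoneda 𝕜 _).obj b)) {M : ℝ} (hM : 0 ≤ M)
    (hσ : ∀ a b, ‖σ a b‖ ≤ M) :
    ∃ τ : φ.toFunctor ⟶ φ'.toFunctor, NatTransBoundedBy τ M ∧
      ∀ a b, τ.app ((yoneda 𝕜 _).obj a, (yoneda 𝕜 _).obj b) = σ a b := by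
  -- First extend in the second variable with a representable fixed in the first. The naturality
  -- required on representables holds automatically over a set.
  choose α hα hα' using fun a => PShv.exists_natTrans_extension (hφ.1 ((yoneda 𝕜 _).obj a))
    (φ'.left ((yoneda 𝕜 _).obj a)) (σ a)
    (fun f => naturality ((yoneda 𝕜 _).comp (φ.left ((yoneda 𝕜 _).obj a)))
      ((yoneda 𝕜 _).comp (φ'.left ((yoneda 𝕜 _).obj a))) (σ a) f) hM (hσ a)
  -- Then, for each `ζ`, extend the components of `α` at `ζ` in the first variable.
  choose β hβ hβ' using fun ζ => PShv.exists_natTrans_extension (hφ.2 ζ) (φ'.right ζ)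
    (fun a => (α a).app ζ)
    (fun f => naturality ((yoneda 𝕜 _).comp (φ.right ζ)) ((yoneda 𝕜 _).comp (φ'.right ζ))
      (fun a => (α a).app ζ) f) hM (fun a => hα a ζ)
  -- Naturality of `β` in `ζ` is not built in. Both sides are transformations out of the
  -- cocontinuous `φ(-, ζ)`, so they may be compared on representables, where the claim is
  -- naturality of `α`.
  have hnat : ∀ {ζ ζ' : PShvSet 𝕜 Y} (g : ζ ⟶ ζ'), φ.rightMap g ≫ β ζ' = β ζ ≫ φ'.rightMap g := by
    intro ζ ζ' g
    refine PShv.natTrans_ext (hφ.2 ζ) fun a => ?_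
    rw [NatTrans.comp_app, NatTrans.comp_app, hβ', hβ']
    exact (α a).naturality g
  -- A morphism of pairs is first `f` with `ζ` fixed, then `g` with `ξ'` fixed; joint naturality
  -- follows from naturality in each variable.
  have hdec : ∀ (ψ : ContractiveBifunctor 𝕜 (PShvSet 𝕜 X) (PShvSet 𝕜 Y) C) {ξ ξ' : PShvSet 𝕜 X}
      {ζ ζ' : PShvSet 𝕜 Y} (f : ξ ⟶ ξ') (g : ζ ⟶ ζ'),
      ψ.map (Prod.mkHom f g) = (ψ.right ζ).map f ≫ (ψ.rightMap g).app ξ' :=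
    fun ψ ξ ξ' ζ ζ' f g => by
    refine Eq.trans ?_ (ψ.map_comp (Prod.mkHom f (𝟙 ζ)) (Prod.mkHom (𝟙 ξ') g))
    simp
  have hnat' : ∀ {ξ ξ' : PShvSet 𝕜 X} {ζ ζ' : PShvSet 𝕜 Y} (f : ξ ⟶ ξ') (g : ζ ⟶ ζ'),
      ((φ.right ζ).map f ≫ (φ.rightMap g).app ξ') ≫ (β ζ').app ξ' =
        (β ζ).app ξ ≫ (φ'.right ζ).map f ≫ (φ'.rightMap g).app ξ' := fun {ξ ξ' ζ ζ'} f g => by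
    have h := congrArg (fun σ => σ.app ξ') (hnat g)
    simp only [NatTrans.comp_app] at h
    rw [Category.assoc, h, ← Category.assoc, (β ζ).naturality f, Category.assoc]
  refine ⟨{ app := fun p => (β p.2).app p.1, naturality := fun p q f => ?_ },
    fun p => hβ p.2 p.1, fun a b => (hβ' ((yoneda 𝕜 _).obj b) a).trans (hα' a b)⟩
  exact (congrArg (· ≫ (β q.2).app q.1) (hdec φ f.1 f.2)).trans ((hnat' f.1 f.2).trans
    (congrArg ((β p.2).app p.1 ≫ ·) (hdec φ' f.1 f.2).symm))

/-- No compatibility among the given isomorphisms is needed, since a family indexed by a set is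
automatically natural. The extensions of the two directions are inverse because they are so on
representables. -/
theorem isometricallyIsomorphic_of_yoneda (hφ : φ.IsBicocontinuous) (hφ' : φ'.IsBicocontinuous)
    (h : ∀ a b, ∃ e : φ.obj ((yoneda 𝕜 _).obj a, (yoneda 𝕜 _).obj b) ≅
      φ'.obj ((yoneda 𝕜 _).obj a, (yoneda 𝕜 _).obj b), ‖e.hom‖ ≤ 1 ∧ ‖e.inv‖ ≤ 1) :
    IsometricallyIsomorphic φ.toFunctor φ'.toFunctor := by
  choose e he he' using h
  obtain ⟨τ, hτ, hτe⟩ := exists_natTrans_extension hφ (fun a b => (e a b).hom) zero_le_one he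
  obtain ⟨τ', hτ', hτe'⟩ := exists_natTrans_extension hφ' (fun a b => (e a b).inv) zero_le_one he'
  refine ⟨⟨τ, τ', natTrans_ext hφ fun a b => ?_, natTrans_ext hφ' fun a b => ?_⟩, hτ, hτ'⟩
  · rw [NatTrans.comp_app, hτe, hτe']
    exact (e a b).hom_inv_id
  · rw [NatTrans.comp_app, hτe, hτe']
    exact (e a b).inv_hom_id

end ContractiveBifunctor

/-! ### The bitensor product of presheaves on sets -/

namespace PShvSet

open PShv FreeBanachCategory

variable {𝕜 : Type v} [RCLike 𝕜] {X Y : Type v}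
  {C : Type u} [Category.{v} C] [NormedCategory C] [BanachCategory 𝕜 C]

/-- `T` is the cocontinuous extension of the family of values of `φ` at pairs of representables.
Precomposed with the tensor bifunctor it is bicocontinuous and agrees with `φ` on such pairs, since
the tensor product of representables is representable and `lan` restricts to `F` there. -/
theorem exists_factorization (hC : IsBanachTwoSpace 𝕜 C)
    (φ : ContractiveBifunctor 𝕜 (PShvSet 𝕜 X) (PShvSet 𝕜 Y) C) (hφ : φ.IsBicocontinuous) :
    ∃ T : ContractiveFunctor 𝕜 (PShvSet 𝕜 (X × Y)) C, T.IsCocontinuous ∧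
      IsometricallyIsomorphic ((tensorBifunctor 𝕜 X Y).toFunctor ⋙ T.toFunctor) φ.toFunctor := by
  let F : ContractiveFunctor 𝕜 (FreeBanachCategory 𝕜 (X × Y)) C :=
    lift 𝕜 fun p => φ.obj ((yoneda 𝕜 _).obj ⟨p.1⟩, (yoneda 𝕜 _).obj ⟨p.2⟩)
  have hT : (lan hC F).IsCocontinuous := lan_isCocontinuous hC F
  refine ⟨lan hC F, hT, ContractiveBifunctor.isometricallyIsomorphic_of_yoneda
    (φ := (tensorBifunctor 𝕜 X Y).comp (lan hC F)) (tensorBifunctor_isBicocontinuous.comp hT) hφ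
    fun a b => ?_⟩
  obtain ⟨e, he, he'⟩ := exists_tensor_yoneda_iso a b
  obtain ⟨e₁, he₁, he₁'⟩ := exists_lan_yoneda_iso hC F ⟨(a.as, b.as)⟩
  refine ⟨(lan hC F).mapIso e ≪≫ e₁, ?_, ?_⟩
  · exact (NormedCategory.norm_comp_le_of_le (((lan hC F).norm_map_le _).trans he) he₁).trans_eq
      (one_mul 1)
  · exact (NormedCategory.norm_comp_le_of_le he₁'
      (((lan hC F).norm_map_le _).trans he')).trans_eq (one_mul 1)

/-- Every representable on `X × Y` is isometrically a tensor product of representables, so `σ`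
prescribes `τ` on representables, and density does the rest. -/
theorem existsUnique_extension {S T : ContractiveFunctor 𝕜 (PShvSet 𝕜 (X × Y)) C}
    (hS : S.IsCocontinuous)
    (σ : (tensorBifunctor 𝕜 X Y).toFunctor ⋙ S.toFunctor ⟶
      (tensorBifunctor 𝕜 X Y).toFunctor ⋙ T.toFunctor) {M : ℝ} (hM : 0 ≤ M)
    (hσ : NatTransBoundedBy σ M) :
    ∃! τ : S.toFunctor ⟶ T.toFunctor, NatTransBoundedBy τ M ∧
      ∀ p, τ.app ((tensorBifunctor 𝕜 X Y).obj p) = σ.app p := by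
  choose e he he' using exists_tensor_yoneda_iso (𝕜 := 𝕜) (X := X) (Y := Y)
  let y := fun z : FreeBanachCategory 𝕜 (X × Y) =>
    ((yoneda 𝕜 (FreeBanachCategory 𝕜 X)).obj ⟨z.as.1⟩,
      (yoneda 𝕜 (FreeBanachCategory 𝕜 Y)).obj ⟨z.as.2⟩)
  let ε : ∀ z, (tensorBifunctor 𝕜 X Y).obj (y z) ≅ (yoneda 𝕜 _).obj z := fun z =>
    e ⟨z.as.1⟩ ⟨z.as.2⟩
  have hε : ∀ z, ‖(ε z).hom‖ ≤ 1 := fun z => he _ _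
  have hε' : ∀ z, ‖(ε z).inv‖ ≤ 1 := fun z => he' _ _
  -- Conjugation by the contractive isomorphisms `ε z` keeps the bound `M`.
  let σ' : ∀ z, S.obj ((yoneda 𝕜 _).obj z) ⟶ T.obj ((yoneda 𝕜 _).obj z) := fun z =>
    S.map (ε z).inv ≫ σ.app (y z) ≫ T.map (ε z).hom
  have hσ' : ∀ z, ‖σ' z‖ ≤ M := fun z => by
    refine (NormedCategory.norm_comp_le_of_le ((S.norm_map_le _).trans (hε' z))
      (NormedCategory.norm_comp_le_of_le (hσ (y z)) ((T.norm_map_le _).trans (hε z)))).trans_eq ?_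
    rw [one_mul, mul_one]
  obtain ⟨τ, hτ, hτ'⟩ := exists_natTrans_extension hS T σ'
    (fun f => naturality ((yoneda 𝕜 _).comp S) ((yoneda 𝕜 _).comp T) σ' f) hM hσ'
  refine ⟨τ, ⟨hτ, fun p => ?_⟩, fun τ' ⟨_, h⟩ => natTrans_ext hS fun z => ?_⟩
  -- Both sides are transformations of bifunctors with bicocontinuous source, so equality on pairs
  -- of representables suffices; there it follows from naturality of `τ` along `ε z`.
  · have : Functor.whiskerLeft (tensorBifunctor 𝕜 X Y).toFunctor τ = σ := by
      refine ContractiveBifunctor.natTrans_ext (φ := (tensorBifunctor 𝕜 X Y).comp S)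
        (φ' := (tensorBifunctor 𝕜 X Y).comp T) (tensorBifunctor_isBicocontinuous.comp hS)
        fun a b => ?_
      let z : FreeBanachCategory 𝕜 (X × Y) := ⟨(a.as, b.as)⟩
      change τ.app ((tensorBifunctor 𝕜 X Y).obj (y z)) = σ.app (y z)
      have h1 := τ.naturality (ε z).hom
      rw [hτ'] at h1
      have h2 : S.map (ε z).hom ≫ σ' z = σ.app (y z) ≫ T.map (ε z).hom := by
        change S.map (ε z).hom ≫ S.map (ε z).inv ≫ σ.app (y z) ≫ T.map (ε z).hom = _
        rw [← Category.assoc, ← S.map_comp, Iso.hom_inv_id, S.map_id, Category.id_comp]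
      have h3 := h1.symm.trans h2
      have : IsIso (T.map (ε z).hom) := inferInstanceAs (IsIso (T.toFunctor.map (ε z).hom))
      exact (cancel_mono (T.map (ε z).hom)).1 h3
    exact congrArg (fun ρ => ρ.app p) this
  -- Naturality of `τ'` along the inverse of `ε z` already forces the value `σ' z`; the norm bound
  -- plays no role in uniqueness.
  · rw [hτ']
    have h1 := τ'.naturality (ε z).inv
    have h2 : τ'.app ((yoneda 𝕜 _).obj z) ≫ T.map (ε z).inv =
        S.map (ε z).inv ≫ σ.app (y z) := by rw [← h1, h]
    change _ = S.map (ε z).inv ≫ σ.app (y z) ≫ T.map (ε z).hom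
    rw [← Category.assoc, ← h2, Category.assoc, ← T.map_comp, Iso.inv_hom_id, T.map_id,
      Category.comp_id]

theorem tensorBifunctor_isBitensorProduct :
    IsBitensorProduct.{v, v + 1, v + 1, v + 1, w} (tensorBifunctor 𝕜 X Y) where
  isBanachTwoSpace := isBanachTwoSpace
  isBicocontinuous := tensorBifunctor_isBicocontinuous
  factorization _ _ _ _ hC φ hφ := exists_factorization hC φ hφ
  extension _ _ _ _ _ _ _ hS _ σ _ hM hσ := existsUnique_extension hS σ hM hσ

end PShvSet

theorem mainTheorem11 (𝕜 : Type v) [RCLike 𝕜] (X Y : Type v) :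
    IsBanachTwoSpace 𝕜 (PShvSet 𝕜 X) ∧ IsBanachTwoSpace 𝕜 (PShvSet 𝕜 Y) ∧
    ∃ i : ContractiveBifunctor 𝕜 (PShvSet 𝕜 X) (PShvSet 𝕜 Y) (PShvSet 𝕜 (X × Y)),
      IsBitensorProduct.{v, v + 1, v + 1, v + 1, w} i ∧
      ∀ (Z : Type (v + 1)) [Category.{v} Z] [NormedCategory Z] [BanachCategory 𝕜 Z]
        (j : ContractiveBifunctor 𝕜 (PShvSet 𝕜 X) (PShvSet 𝕜 Y) Z),
        IsBitensorProduct.{v, v + 1, v + 1, v + 1, v + 1} j →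
        ∃ E : ContractiveFunctor 𝕜 Z (PShvSet 𝕜 (X × Y)), E.IsBanachEquivalence ∧
          IsometricallyIsomorphic (j.toFunctor ⋙ E.toFunctor) i.toFunctor :=
  ⟨PShvSet.isBanachTwoSpace, PShvSet.isBanachTwoSpace, PShvSet.tensorBifunctor 𝕜 X Y,
    PShvSet.tensorBifunctor_isBitensorProduct, fun _ _ _ _ _ hj =>
      hj.exists_equivalence PShvSet.tensorBifunctor_isBitensorProduct⟩
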